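/- Let $G$ be a connected real reductive Lie group (in the sense of Knapp) with Cartan involution $\Theta$, maximal compact subgroup $K=G^{\Theta}$ and Cartan decomposition $\mathfrak g=\mathfrak k\oplus\mathfrak p$, $K\times\mathfrak p\simeq G$, $(k,X)\mapsto k\exp X$. Let $b$ be an $\mathrm{Ad}(G)$-invariant symmetric bilinear form on $\mathfrak g$ such that $(X,Y):=-b(X,\Theta Y)$ is a scalar product, and equip $\mathfrak g^*$ and $\mathfrak k^*$ with the induced norms $\|\cdot\|$. Let $(M,\Omega_M)$ be a connected symplectic manifold with a Hamiltonian action of $G$, i.e. a smooth action by symplectomorphisms together with a smooth $G$-equivariant map $\Phi^G_M:M\to\mathfrak g^*$ satisfying $\iota(X_M)\Omega_M=-d\langle\Phi^G_M,X\rangle$ for all $X\in\mathfrak g$, where $X_M(m)=\frac{d}{ds}\big|_{s=0}e^{-sX}\cdot m$. Write $\Phi^K_M:M\to\mathfrak k^*$ and $\Phi^{\mathfrak p}_M:M\to\mathfrak p^*$ for the components of $\Phi^G_M$ (its restrictions to $\mathfrak k$ and $\mathfrak p$), $Y:=(\Phi^{\mathfrak p}_M)^{-1}(0)\subset M$, and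 $\Phi^K_Y:=\Phi^K_M|_Y$. For a smooth function $f$, let $\mathrm{Cr}(f)$ be its set of critical points. Suppose that the action of $G$ on $M$ is proper, i.e. $\{g\in G : g\cdot A\cap A\neq\emptyset\}$ is compact for every compact $A\subset M$ (in this case $Y$ is a sub-manifold of $M$). Then: 1. $\Phi^G_M$ is a proper map if and only if $\Phi^K_M$ is a proper map. 2. If $\Phi^G_M$ is a proper map, then $$\emptyset\neq\mathrm{Cr}(\|\Phi^G_M\|^2)=\mathrm{Cr}(\|\Phi^K_M\|^2)=\mathrm{Cr}(\|\Phi^K_Y\|^2)\subset Y .$$ -/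

import Mathlib

open scoped Manifold ContDiff Topology

noncomputable section

section LieGroups

variable {E : Type*} [NormedAddCommGroup E] [NormedSpace ℝ E]
  {G : Type*} [TopologicalSpace G] [ChartedSpace E G] [Group G]

/-- `γ` is the smooth one-parameter subgroup of `G` with initial velocity `X`. Since `γ 0 = 1`,
the velocity at `0`, which lies in the tangent space at `γ 0`, is an element of the Lie algebra. -/
def IsOneParameterSubgroup (X : GroupLieAlgebra 𝓘(ℝ, E) G) (γ : ℝ → G) : Prop :=
  ContMDiff 𝓘(ℝ, ℝ) 𝓘(ℝ, E) ∞ γ ∧ (∀ s t : ℝ, γ (s + t) = γ s * γ t) ∧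
    (mfderiv 𝓘(ℝ, ℝ) 𝓘(ℝ, E) γ 0 (1 : ℝ) : E) = X

open Classical in
/-- The exponential map of a Lie group: `exp X = γ 1`, where `γ` is the one-parameter subgroup
with initial velocity `X` (which exists and is unique in every Lie group). -/
def lieExp (X : GroupLieAlgebra 𝓘(ℝ, E) G) : G :=
  if h : ∃ γ : ℝ → G, IsOneParameterSubgroup X γ then h.choose 1 else 1

/-- The adjoint representation: the differential at `1` of the conjugation by `g`. -/
def lieAd (g : G) : GroupLieAlgebra 𝓘(ℝ, E) G →L[ℝ] GroupLieAlgebra 𝓘(ℝ, E) G :=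
  mfderiv 𝓘(ℝ, E) 𝓘(ℝ, E) (fun x : G => g * x * g⁻¹) 1

/-- The differential at `1` of a group endomorphism. -/
def lieDiff (Θ : G →* G) : GroupLieAlgebra 𝓘(ℝ, E) G →L[ℝ] GroupLieAlgebra 𝓘(ℝ, E) G :=
  mfderiv 𝓘(ℝ, E) 𝓘(ℝ, E) Θ 1

/-- The subgroup of fixed points of a group endomorphism. -/
def fixedSubgroup (Θ : G →* G) : Subgroup G := Θ.eqLocus (MonoidHom.id G)

/-- The Lie algebra `𝔨` of the fixed subgroup: the `1`-eigenspace of the differential. -/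
def fixedPart (Θ : G →* G) : Submodule ℝ (GroupLieAlgebra 𝓘(ℝ, E) G) :=
  Module.End.eigenspace (lieDiff (E := E) Θ : Module.End ℝ (GroupLieAlgebra 𝓘(ℝ, E) G)) 1

/-- The `(-1)`-eigenspace `𝔭` of the differential. -/
def antiFixedPart (Θ : G →* G) : Submodule ℝ (GroupLieAlgebra 𝓘(ℝ, E) G) :=
  Module.End.eigenspace (lieDiff (E := E) Θ : Module.End ℝ (GroupLieAlgebra 𝓘(ℝ, E) G)) (-1)

variable (E G) in
/-- A real reductive structure on a connected Lie group `G`, in the sense of Knapp: a (global)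
Cartan involution `Θ` with compact fixed group `K`, an `Ad(G)`-invariant symmetric bilinear form
`b` on the Lie algebra such that `(X, Y) ↦ -b(X, θ Y)`, with `θ` the differential of `Θ`, is a
scalar product, and the global Cartan decomposition `K × 𝔭 ≃ G`, `(k, X) ↦ k exp X`
(this smooth map is always a local diffeomorphism, so it is a diffeomorphism as soon as it is a
homeomorphism). Non-degeneracy of `b`, reductivity of the Lie algebra, `𝔤 = 𝔨 ⊕ 𝔭`, `b`-orthogonality
of `𝔨` and `𝔭`, connectedness and maximality of `K` follow from this, as does Knapp's condition on
inner automorphisms for connected `G`. -/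
structure RealReductive where
  /-- the Cartan involution of the group -/
  Θ : G →* G
  smooth_Θ : ContMDiff 𝓘(ℝ, E) 𝓘(ℝ, E) ∞ Θ
  involutive_Θ : ∀ g, Θ (Θ g) = g
  isCompact_K : IsCompact (fixedSubgroup Θ : Set G)
  /-- the invariant bilinear form on the Lie algebra -/
  b : LinearMap.BilinForm ℝ (GroupLieAlgebra 𝓘(ℝ, E) G)
  symm_b : ∀ X Y, b X Y = b Y X
  invariant_b : ∀ (g : G) X Y, b (lieAd g X) (lieAd g Y) = b X Y
  theta_b : ∀ X Y, b (lieDiff Θ X) (lieDiff Θ Y) = b X Y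
  pos_b : ∀ X, X ≠ 0 → 0 < -b X (lieDiff Θ X)
  cartan_decomposition : IsHomeomorph
    (fun p : fixedSubgroup Θ × antiFixedPart (E := E) Θ =>
      (p.1 : G) * lieExp (p.2 : GroupLieAlgebra 𝓘(ℝ, E) G))

namespace RealReductive

variable (R : RealReductive E G)

/-- The maximal compact subgroup `K`. -/
def K : Subgroup G := fixedSubgroup R.Θ

/-- The Lie algebra `𝔨` of `K`. -/
def 𝔨 : Submodule ℝ (GroupLieAlgebra 𝓘(ℝ, E) G) := fixedPart R.Θ

/-- The complement `𝔭` in the Cartan decomposition `𝔤 = 𝔨 ⊕ 𝔭`. -/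
def 𝔭 : Submodule ℝ (GroupLieAlgebra 𝓘(ℝ, E) G) := antiFixedPart R.Θ

/-- The scalar product `(X, Y) = -b(X, θ Y)` on `𝔤`. -/
def scalar : LinearMap.BilinForm ℝ (GroupLieAlgebra 𝓘(ℝ, E) G) :=
  -(R.b.compl₂ (lieDiff (E := E) R.Θ).toLinearMap)

theorem scalar_apply (X Y : GroupLieAlgebra 𝓘(ℝ, E) G) :
    R.scalar X Y = -R.b X (lieDiff R.Θ Y) := rfl

theorem scalar_pos (X : GroupLieAlgebra 𝓘(ℝ, E) G) (hX : X ≠ 0) : 0 < R.scalar X X :=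
  R.pos_b X hX

end RealReductive

/-- A positive definite form is nondegenerate. -/
theorem bilinForm_nondegenerate_of_pos {V : Type*} [AddCommGroup V] [Module ℝ V]
    (B : LinearMap.BilinForm ℝ V) (h : ∀ X, X ≠ 0 → 0 < B X X) : B.Nondegenerate := by
  constructor
  · intro X hX
    by_contra h0
    exact (h X h0).ne' (hX X)
  · intro X hX
    by_contra h0
    exact (h X h0).ne' (hX X)

/-- The squared norm on `V*` induced by a scalar product `B` on `V`: `‖ξ‖² = B(ξ~, ξ~)`, where
`ξ~ ∈ V` is defined by `B(ξ~, X) = ⟨ξ, X⟩` for all `X ∈ V`. -/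
def dualNormSq {V : Type*} [AddCommGroup V] [Module ℝ V] [FiniteDimensional ℝ V]
    (B : LinearMap.BilinForm ℝ V) (hB : B.Nondegenerate) (ξ : Module.Dual ℝ V) : ℝ :=
  B ((B.toDual hB).symm ξ) ((B.toDual hB).symm ξ)

instance instFiniteDimensionalGroupLieAlgebra [FiniteDimensional ℝ E] :
    FiniteDimensional ℝ (GroupLieAlgebra 𝓘(ℝ, E) G) :=
  inferInstanceAs (FiniteDimensional ℝ E)

namespace RealReductive

variable [FiniteDimensional ℝ E] (R : RealReductive E G)

/-- The squared norm on `𝔤*`. -/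
def normSq (ξ : StrongDual ℝ (GroupLieAlgebra 𝓘(ℝ, E) G)) : ℝ :=
  dualNormSq R.scalar (bilinForm_nondegenerate_of_pos _ R.scalar_pos) ξ.toLinearMap

/-- The squared norm on `𝔨*`, for the restriction to `𝔨` of the scalar product. -/
def normSqK (ξ : StrongDual ℝ R.𝔨) : ℝ :=
  dualNormSq (R.scalar.restrict R.𝔨)
    (bilinForm_nondegenerate_of_pos _ fun X hX =>
      R.scalar_pos X (fun h => hX (Subtype.ext h))) ξ.toLinearMap

end RealReductive

end LieGroups

section Symplectic

variable {F : Type*} [NormedAddCommGroup F] [NormedSpace ℝ F]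
  {M : Type*} [TopologicalSpace M] [ChartedSpace F M]

/-- The expression of a differential `2`-form on `M` in the chart `e`: its pull-back under
the inverse of `e`, a form on the target of `e`. -/
def formInChart (Ω : ∀ m : M, TangentSpace 𝓘(ℝ, F) m [⋀^Fin 2]→L[ℝ] ℝ)
    (e : OpenPartialHomeomorph M F) (x : F) : F [⋀^Fin 2]→L[ℝ] ℝ :=
  (Ω (e.symm x)).compContinuousLinearMap (mfderiv 𝓘(ℝ, F) 𝓘(ℝ, F) e.symm x)

/-- A symplectic form: a smooth, closed, nondegenerate differential `2`-form. -/
structure IsSymplecticForm (Ω : ∀ m : M, TangentSpace 𝓘(ℝ, F) m [⋀^Fin 2]→L[ℝ] ℝ) : Prop where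
  smooth : ∀ e ∈ atlas F M, ContDiffOn ℝ ∞ (formInChart Ω e) e.target
  closed : ∀ e ∈ atlas F M, ∀ x ∈ e.target, extDeriv (formInChart Ω e) x = 0
  nondegenerate : ∀ (m : M) (v : TangentSpace 𝓘(ℝ, F) m),
    (∀ w : TangentSpace 𝓘(ℝ, F) m, Ω m ![v, w] = 0) → v = 0

variable (F) in
/-- The critical points of a function on `M`. -/
def criticalSet (f : M → ℝ) : Set M :=
  {m | mfderiv 𝓘(ℝ, F) 𝓘(ℝ, ℝ) f m = 0}

variable (F) in
/-- The critical points of the restriction of `f` to a (sub-manifold) `S` of `M`: the points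
`y` of `S` at which `f` has zero derivative along every smooth curve `γ` in `M` through `y`
that stays in `S`. (The velocities of these curves form the tangent space of `S` at `y`.) -/
def criticalSetOn (f : M → ℝ) (S : Set M) : Set M :=
  {y | y ∈ S ∧ ∀ (ε : ℝ) (γ : ℝ → M), 0 < ε →
    ContMDiffOn 𝓘(ℝ, ℝ) 𝓘(ℝ, F) ∞ γ (Set.Ioo (-ε) ε) →
    (∀ t ∈ Set.Ioo (-ε) ε, γ t ∈ S) → γ 0 = y → deriv (f ∘ γ) 0 = 0}

end Symplectic

section Hamiltonian

variable {E : Type*} [NormedAddCommGroup E] [NormedSpace ℝ E]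
  {G : Type*} [TopologicalSpace G] [ChartedSpace E G] [Group G]
  {F : Type*} [NormedAddCommGroup F] [NormedSpace ℝ F]
  {M : Type*} [TopologicalSpace M] [ChartedSpace F M] [MulAction G M]

variable (F) in
/-- The vector field `X_M(m) = d/ds (exp(-sX) • m)` at `s = 0` generated by `X ∈ 𝔤`, that is,
minus the image of `X` under the differential at `1` of the orbit map `g ↦ g • m`. -/
def generatedVectorField
    (X : GroupLieAlgebra 𝓘(ℝ, E) G) (m : M) : TangentSpace 𝓘(ℝ, F) m :=
  -(mfderiv 𝓘(ℝ, E) 𝓘(ℝ, F) (fun g : G => g • m) 1 X : F)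

/-- `(M, Ω, Φ)` is a Hamiltonian `G`-manifold: `Ω` is a symplectic form on `M`, `G` acts smoothly
on `M` by symplectomorphisms, and `Φ : M → 𝔤*` is a moment map, i.e. a smooth `G`-equivariant
map with `ι(X_M) Ω = -d⟨Φ, X⟩` for all `X ∈ 𝔤`. -/
structure IsHamiltonian (Ω : ∀ m : M, TangentSpace 𝓘(ℝ, F) m [⋀^Fin 2]→L[ℝ] ℝ)
    (Φ : M → StrongDual ℝ (GroupLieAlgebra 𝓘(ℝ, E) G)) : Prop where
  symplectic : IsSymplecticForm Ω
  smooth_action : ContMDiff (𝓘(ℝ, E).prod 𝓘(ℝ, F)) 𝓘(ℝ, F) ∞ (fun p : G × M => p.1 • p.2)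
  invariant : ∀ (g : G) (m : M) (v w : TangentSpace 𝓘(ℝ, F) m),
    Ω (g • m) ![mfderiv 𝓘(ℝ, F) 𝓘(ℝ, F) (fun x : M => g • x) m v,
      mfderiv 𝓘(ℝ, F) 𝓘(ℝ, F) (fun x : M => g • x) m w] = Ω m ![v, w]
  smooth_moment : ∀ X, ContMDiff 𝓘(ℝ, F) 𝓘(ℝ, ℝ) ∞ (fun m => Φ m X)
  moment : ∀ (X : GroupLieAlgebra 𝓘(ℝ, E) G) (m : M) (v : TangentSpace 𝓘(ℝ, F) m),
    Ω m ![generatedVectorField F X m, v] =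
      -(mfderiv 𝓘(ℝ, F) 𝓘(ℝ, ℝ) (fun x => Φ x X) m v : ℝ)
  equivariant : ∀ (g : G) (m : M) (X : GroupLieAlgebra 𝓘(ℝ, E) G),
    Φ (g • m) (lieAd g X) = Φ m X

/-- The action of `G` on `M` is proper: for every compact subset `A` of `M`, the set of all
`g ∈ G` with `g • A ∩ A ≠ ∅` is compact. -/
def IsProperAction (G M : Type*) [TopologicalSpace G] [Group G] [TopologicalSpace M]
    [MulAction G M] : Prop :=
  ∀ A : Set M, IsCompact A → IsCompact {g : G | ∃ a ∈ A, g • a ∈ A}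

namespace RealReductive

variable (R : RealReductive E G) (Φ : M → StrongDual ℝ (GroupLieAlgebra 𝓘(ℝ, E) G))

/-- The component `Φ^K : M → 𝔨*` of `Φ`, a moment map for the `K`-action. -/
def momentK (m : M) : StrongDual ℝ R.𝔨 := (Φ m).comp R.𝔨.subtypeL

/-- The component `Φ^𝔭 : M → 𝔭*` of `Φ`. -/
def momentP (m : M) : StrongDual ℝ R.𝔭 := (Φ m).comp R.𝔭.subtypeL

/-- The slice `Y`, the zero fibre of `Φ^𝔭`. -/
def slice : Set M := {m | R.momentP Φ m = 0}

end RealReductive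

end Hamiltonian

end

/-!
Let `ξ` be the vector dual to `Φ(m)` for the scalar product, `ξ = k + p` with `k ∈ 𝔨`, `p ∈ 𝔭`; the
vector dual to `Φ(m)` for the invariant form `b` is `η = -θ ξ = -k + p`. Equivariance of `Φ` says
that `η` at `g • m` is `Ad(g) η`.

Everything rests on `IsHamiltonian.eq_zero_of_modelBracket_eq_zero`: if `Φ` is proper, `X ∈ 𝔭` and
`[X, η] = 0`, then `X = 0`. Indeed `Φ` is constant along `exp(tX) • m`, which therefore stays in a
compact fibre of `Φ`; as the action is proper, `exp(tX)` stays in a compact subset of `G`, and the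
Cartan decomposition forces `X = 0`. In particular `[k, p] = 0` implies `p = 0`, that is `m ∈ Y`
(`IsHamiltonian.mem_slice_of_modelBracket_eq_zero`).

* A critical point of `‖Φ‖²` is a zero of the vector field generated by `ξ`, as `Ω` is
  nondegenerate; hence `0 = [ξ, η] = 2 [k, p]`. For `‖Φ^K‖²` the field is generated by `k`, and
  `0 = [k, η] = [k, p]`. So both critical sets lie in `Y`; they agree because there `ξ = k`. A minimum
  of the proper function `‖Φ‖²` is a critical point.
* A minimum of `‖Φ‖²` on an orbit exists by properness of `Φ` and of the action, and satisfies
  `[ξ, θ ξ] = 0`, so that it lies in `Y`; thus every orbit meets `Y`. The invariant function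
  `-b(η, η) = ‖Φ^K‖² - ‖Φ^𝔭‖²` is nonnegative on `Y`, hence everywhere, and `‖Φ‖² ≤ 2 ‖Φ^K‖²`
  (`IsHamiltonian.normSq_le_two_mul`), which makes `Φ^K` proper.
* At `y ∈ Y` the map `𝔭 → 𝔭*`, `X ↦ dΦ^𝔭(X_M)`, is injective, again by the central fact. So `Φ^𝔭`
  is a submersion at `y`, and `T_y M` is the sum of `ker dΦ^𝔭 = T_y Y` and of the directions of
  `𝔭`, which annihilate `‖Φ^K‖²` to first order by invariance of `b`. Hence a critical point of the
  restriction to `Y` is a critical point on `M` (`IsHamiltonian.criticalSetOn_subset`).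

Tangent spaces are definitionally the model spaces `E` and `F`; the computations are carried out in
the latter, on the copies `modelAd`, `modelForm`, `modelMoment` of the structures involved. The
bracket is used only in the form of the differential of `Ad` at `1`; its antisymmetry comes from
local one-parameter subgroups.
-/

open scoped Manifold ContDiff Topology

noncomputable section

/-! ### The adjoint representation -/

section AdjointRepresentation

variable {E : Type*} [NormedAddCommGroup E] [NormedSpace ℝ E]
  {G : Type*} [TopologicalSpace G] [ChartedSpace E G] [Group G]

/-- The adjoint representation `lieAd`, with the Lie algebra identified with the model space `E`
(it is `E` by definition, as a tangent space). -/
def modelAd (g : G) : E →L[ℝ] E := lieAd g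

variable (E G) in
/-- The differential at `1` of the adjoint representation, `Z ↦ (X ↦ [Z, X])`. -/
def modelBracket : E →L[ℝ] E →L[ℝ] E :=
  mfderiv 𝓘(ℝ, E) 𝓘(ℝ, E →L[ℝ] E) (modelAd : G → E →L[ℝ] E) 1

theorem modelAd_one : modelAd (1 : G) = ContinuousLinearMap.id ℝ E := by
  have h : (fun x : G => 1 * x * 1⁻¹) = id := by ext; simp
  change mfderiv 𝓘(ℝ, E) 𝓘(ℝ, E) (fun x : G => 1 * x * 1⁻¹) 1 = _
  rw [h]
  exact mfderiv_id

variable [LieGroup 𝓘(ℝ, E) ∞ G]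

theorem contMDiff_conj (g : G) : ContMDiff 𝓘(ℝ, E) 𝓘(ℝ, E) ∞ (fun x : G => g * x * g⁻¹) :=
  (contMDiff_const.mul contMDiff_id).mul contMDiff_const

theorem hasMFDerivAt_conj (g : G) :
    HasMFDerivAt 𝓘(ℝ, E) 𝓘(ℝ, E) (fun x : G => g * x * g⁻¹) 1 (lieAd (E := E) g) :=
  ((contMDiff_conj g).mdifferentiable (by simp) 1).hasMFDerivAt

theorem modelAd_mul (g h : G) : modelAd (g * h) = (modelAd g : E →L[ℝ] E).comp (modelAd h) := by
  have hc : (fun x : G => g * h * x * (g * h)⁻¹) =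
      (fun x : G => g * x * g⁻¹) ∘ (fun x : G => h * x * h⁻¹) := by
    ext x; simp [mul_assoc]
  have h1 : HasMFDerivAt 𝓘(ℝ, E) 𝓘(ℝ, E) (fun x : G => g * x * g⁻¹) (h * 1 * h⁻¹)
      (modelAd (E := E) g) := by
    have := hasMFDerivAt_conj (E := E) g
    rw [show (h * 1 * h⁻¹ : G) = 1 by simp]
    exact this
  have := HasMFDerivAt.comp (1 : G) h1 (hasMFDerivAt_conj (E := E) h)
  rw [← hc] at this
  exact this.mfderiv

/-- The adjoint representation is differentiable: it is the partial differential at `(g, 1)` of the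
smooth map `(g, x) ↦ g x g⁻¹`, which sends `(g, 1)` to the fixed point `1`. -/
theorem contMDiff_modelAd : ContMDiff 𝓘(ℝ, E) 𝓘(ℝ, E →L[ℝ] E) 1 (modelAd : G → E →L[ℝ] E) := by
  intro g
  have h1 : ContMDiffAt (𝓘(ℝ, E).prod 𝓘(ℝ, E)) 𝓘(ℝ, E) ∞
      (Function.uncurry fun g x : G => g * x * g⁻¹) (g, 1) := by
    have : ContMDiff (𝓘(ℝ, E).prod 𝓘(ℝ, E)) 𝓘(ℝ, E) ∞ (fun p : G × G => p.1 * p.2 * p.1⁻¹) :=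
      (contMDiff_fst.mul contMDiff_snd).mul contMDiff_fst.inv
    exact this _
  have := ContMDiffAt.mfderiv (m := 1) (fun g x : G => g * x * g⁻¹) (fun _ => (1 : G)) h1
    contMDiffAt_const (n := ∞) (WithTop.coe_le_coe.2 (le_top : (1 + 1 : ℕ∞) ≤ ⊤))
  -- both base points are constantly `1`, so the coordinate changes are trivial
  refine this.congr_of_eventuallyEq (Filter.Eventually.of_forall fun x => ?_)
  have hx : ∀ x : G, x * 1 * x⁻¹ = 1 := by simp
  refine Eq.trans ?_ (inTangentCoordinates_eq (fun _ : G => (1 : G)) (fun x : G => x * 1 * x⁻¹)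
    (fun x : G => (modelAd x : E →L[ℝ] E)) (mem_chart_source E (1 : G))
    (by rw [hx, hx]; exact mem_chart_source E (1 : G))).symm
  rw [hx, hx]
  ext v
  exact (((tangentBundleCore 𝓘(ℝ, E) G).coordChange_self _ _ (mem_chart_source E (1 : G)) _).trans
    (congrArg (modelAd x) ((tangentBundleCore 𝓘(ℝ, E) G).coordChange_self _ _
      (mem_chart_source E (1 : G)) _))).symm

end AdjointRepresentation

/-! ### One-parameter subgroups -/

section LocalOneParameterSubgroups

theorem ContinuousLinearMap.comp_one_smulRight {V W : Type*} [NormedAddCommGroup V]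
    [NormedSpace ℝ V] [NormedAddCommGroup W] [NormedSpace ℝ W] (A : V →L[ℝ] W) (v : V) :
    A.comp ((1 : ℝ →L[ℝ] ℝ).smulRight v) = (1 : ℝ →L[ℝ] ℝ).smulRight (A v) := by
  ext; simp

theorem hasMFDerivAt_comp_add {E : Type*} [NormedAddCommGroup E] [NormedSpace ℝ E]
    {M : Type*} [TopologicalSpace M] [ChartedSpace E M] {γ : ℝ → M} {v : E} (s t : ℝ)
    (h : HasMFDerivAt 𝓘(ℝ, ℝ) 𝓘(ℝ, E) γ (s + t) ((1 : ℝ →L[ℝ] ℝ).smulRight v)) :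
    HasMFDerivAt 𝓘(ℝ, ℝ) 𝓘(ℝ, E) (fun r => γ (s + r)) t ((1 : ℝ →L[ℝ] ℝ).smulRight v) := by
  have h1 : HasMFDerivAt 𝓘(ℝ, ℝ) 𝓘(ℝ, ℝ) (fun r : ℝ => s + r) t (ContinuousLinearMap.id ℝ ℝ) :=
    ((hasFDerivAt_id t).const_add s).hasMFDerivAt
  exact HasMFDerivAt.comp t h h1

variable {E : Type*} [NormedAddCommGroup E] [NormedSpace ℝ E]
  {G : Type*} [TopologicalSpace G] [ChartedSpace E G] [Group G] [LieGroup 𝓘(ℝ, E) ∞ G]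

theorem hasDerivAt_modelAd_comp {γ : ℝ → G} {X : E} (h0 : γ 0 = 1)
    (hγ : HasMFDerivAt 𝓘(ℝ, ℝ) 𝓘(ℝ, E) γ 0 ((1 : ℝ →L[ℝ] ℝ).smulRight X)) :
    HasDerivAt (fun t => (modelAd (γ t) : E →L[ℝ] E)) (modelBracket E G X) 0 := by
  have h1 : HasMFDerivAt 𝓘(ℝ, E) 𝓘(ℝ, E →L[ℝ] E) (modelAd : G → E →L[ℝ] E) (γ 0)
      (modelBracket E G) := by
    rw [h0]
    exact (contMDiff_modelAd.mdifferentiable (by simp) 1).hasMFDerivAt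
  have h2 : HasFDerivAt (fun t => (modelAd (γ t) : E →L[ℝ] E))
      ((modelBracket E G).comp ((1 : ℝ →L[ℝ] ℝ).smulRight X)) 0 :=
    (HasMFDerivAt.comp (0 : ℝ) h1 hγ).hasFDerivAt
  exact h2.hasDerivAt.congr_deriv (congrArg (modelBracket E G) (one_smul ℝ X))

theorem contMDiff_mulInvariantVectorField_one (X : E) :
    ContMDiff 𝓘(ℝ, E) 𝓘(ℝ, E).tangent 1
      (fun g : G =>
        (⟨g, mulInvariantVectorField (I := 𝓘(ℝ, E)) X g⟩ : TangentBundle 𝓘(ℝ, E) G)) := by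
  have : LieGroup 𝓘(ℝ, E) (minSmoothness ℝ 3) G := by
    simp only [minSmoothness_of_isRCLikeNormedField]
    exact LieGroup.of_le (n := ∞) (WithTop.coe_le_coe.2 (le_top : (3 : ℕ∞) ≤ ⊤))
  refine (contMDiff_mulInvariantVectorField (I := 𝓘(ℝ, E)) (G := G) X).of_le ?_
  simp only [minSmoothness_of_isRCLikeNormedField]
  exact_mod_cast one_le_two

/-- Left translation preserves the integral curves of a left invariant vector field. -/
theorem hasMFDerivAt_mul_left_of_integralCurve {X : E} {γ : ℝ → G} {t : ℝ} (g : G)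
    (h : HasMFDerivAt 𝓘(ℝ, ℝ) 𝓘(ℝ, E) γ t
      ((1 : ℝ →L[ℝ] ℝ).smulRight (mulInvariantVectorField (I := 𝓘(ℝ, E)) X (γ t)))) :
    HasMFDerivAt 𝓘(ℝ, ℝ) 𝓘(ℝ, E) (fun s => g * γ s) t
      ((1 : ℝ →L[ℝ] ℝ).smulRight (mulInvariantVectorField (I := 𝓘(ℝ, E)) X (g * γ t))) := by
  have hL : ∀ a x : G, MDifferentiableAt 𝓘(ℝ, E) 𝓘(ℝ, E) (fun y : G => a * y) x := fun a x =>
    (contMDiff_mul_left (I := 𝓘(ℝ, E)) (n := ∞) (a := a)).mdifferentiable (by simp) x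
  have h1 := HasMFDerivAt.comp t (hL g (γ t)).hasMFDerivAt h
  have hc : (fun y : G => g * γ t * y) = (fun y : G => g * y) ∘ (fun y : G => γ t * y) := by
    ext y; simp [mul_assoc]
  have h2 : mulInvariantVectorField (I := 𝓘(ℝ, E)) X (g * γ t) =
      mfderiv 𝓘(ℝ, E) 𝓘(ℝ, E) (fun y : G => g * y) (γ t)
        (mulInvariantVectorField (I := 𝓘(ℝ, E)) X (γ t)) := by
    have h3 : HasMFDerivAt 𝓘(ℝ, E) 𝓘(ℝ, E) (fun y : G => g * y) (γ t * 1)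
        (mfderiv 𝓘(ℝ, E) 𝓘(ℝ, E) (fun y : G => g * y) (γ t) : E →L[ℝ] E) := by
      rw [mul_one]
      exact (hL g (γ t)).hasMFDerivAt
    have h4 := (HasMFDerivAt.comp (1 : G) h3 (hL (γ t) 1).hasMFDerivAt).mfderiv
    rw [← hc] at h4
    exact congrArg (fun A : E →L[ℝ] E => A X) h4
  refine h1.congr_mfderiv ?_
  rw [h2]
  exact ContinuousLinearMap.comp_one_smulRight (V := E) (W := E) _ _

/-- Local one-parameter subgroups exist: they are the integral curves through `1` of left
invariant vector fields. -/
theorem exists_local_oneParameterSubgroup [CompleteSpace E] [T2Space G] (X : E) :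
    ∃ (γ : ℝ → G) (ε : ℝ), 0 < ε ∧ γ 0 = 1 ∧
      HasMFDerivAt 𝓘(ℝ, ℝ) 𝓘(ℝ, E) γ 0 ((1 : ℝ →L[ℝ] ℝ).smulRight X) ∧
      ∀ s ∈ Set.Ioo (-ε) ε, ∀ t ∈ Set.Ioo (-ε) ε, γ (s + t) = γ s * γ t := by
  obtain ⟨γ, h0, hγ⟩ := exists_isMIntegralCurveAt_of_contMDiffAt_boundaryless (M := G)
    (I := 𝓘(ℝ, E)) 0 (contMDiff_mulInvariantVectorField_one X 1)
  obtain ⟨ε, hε, hI⟩ := Metric.eventually_nhds_iff_ball.1 hγ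
  rw [Real.ball_eq_Ioo, zero_sub, zero_add] at hI
  refine ⟨γ, ε / 2, by positivity, h0, ?_, fun s hs t ht => ?_⟩
  · have := hI 0 ⟨by linarith, hε⟩
    have h1 : mulInvariantVectorField (I := 𝓘(ℝ, E)) (G := G) X (γ 0) = X := by
      rw [h0]
      have : (fun y : G => 1 * y) = id := by ext; simp
      unfold mulInvariantVectorField
      rw [this]
      exact congrArg (fun A : E →L[ℝ] E => A X) (mfderiv_id (I := 𝓘(ℝ, E)) (x := (1 : G)))
    rw [h1] at this
    exact this
  -- `r ↦ γ (s + r)` and `r ↦ γ s * γ r` are integral curves with the same initial value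
  · have hA : IsMIntegralCurveOn (fun r => γ (s + r))
        (fun g : G => mulInvariantVectorField (I := 𝓘(ℝ, E)) X g) (Set.Ioo (-(ε / 2)) (ε / 2)) := by
      intro r hr
      exact (hasMFDerivAt_comp_add s r (hI (s + r)
        ⟨by linarith [hs.1, hr.1], by linarith [hs.2, hr.2]⟩)).hasMFDerivWithinAt
    have hB : IsMIntegralCurveOn (fun r => γ s * γ r)
        (fun g : G => mulInvariantVectorField (I := 𝓘(ℝ, E)) X g) (Set.Ioo (-(ε / 2)) (ε / 2)) := by
      intro r hr
      exact (hasMFDerivAt_mul_left_of_integralCurve (γ s) (hI r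
        ⟨by linarith [hr.1], by linarith [hr.2]⟩)).hasMFDerivWithinAt
    exact isMIntegralCurveOn_Ioo_eqOn_of_contMDiff_boundaryless (t₀ := 0)
      ⟨by linarith, by linarith⟩ (contMDiff_mulInvariantVectorField_one X) hA hB (by simp [h0]) ht

theorem modelBracket_self [CompleteSpace E] [T2Space G] (X : E) : modelBracket E G X X = 0 := by
  obtain ⟨γ, ε, hε, h0, hγ, hmul⟩ := exists_local_oneParameterSubgroup (G := G) X
  have hd := (hasDerivAt_modelAd_comp h0 hγ).clm_apply (hasDerivAt_const (0 : ℝ) X)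
  have hI : Set.Ioo (-ε) ε ∈ 𝓝 (0 : ℝ) := Ioo_mem_nhds (by linarith) hε
  -- conjugation by `γ t` fixes `γ s` for small `s`, hence `Ad (γ t) X = X`
  have hfix : ∀ t ∈ Set.Ioo (-ε) ε, modelAd (γ t) X = X := by
    intro t ht
    have h1 : HasMFDerivAt 𝓘(ℝ, E) 𝓘(ℝ, E) (fun x : G => γ t * x * (γ t)⁻¹) (γ 0)
        (modelAd (γ t) : E →L[ℝ] E) := by
      rw [h0]; exact hasMFDerivAt_conj (E := E) (γ t)
    have h2 := HasMFDerivAt.comp (0 : ℝ) h1 hγ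
    have h3 : (fun x : G => γ t * x * (γ t)⁻¹) ∘ γ =ᶠ[𝓝 0] γ := by
      filter_upwards [hI] with s hs
      simp [← hmul t ht s hs, add_comm t s, hmul s hs t ht]
    have h4 := hasMFDerivAt_unique (h2.congr_of_eventuallyEq h3.symm) hγ
    have h5 : (1 : ℝ →L[ℝ] ℝ).smulRight (modelAd (γ t) X) = (1 : ℝ →L[ℝ] ℝ).smulRight X :=
      (ContinuousLinearMap.comp_one_smulRight _ _).symm.trans h4
    simpa using congrArg (fun A : ℝ →L[ℝ] E => A 1) h5
  have hc : (fun t => modelAd (γ t) X) =ᶠ[𝓝 0] fun _ => X := by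
    filter_upwards [hI] with t ht using hfix t ht
  have := hd.unique ((hasDerivAt_const (0 : ℝ) X).congr_of_eventuallyEq hc)
  simpa using this

theorem modelBracket_skew [CompleteSpace E] [T2Space G] (X Y : E) :
    modelBracket E G X Y = -modelBracket E G Y X := by
  have := modelBracket_self (G := G) (X + Y)
  simp only [map_add, add_apply, modelBracket_self, zero_add, add_zero] at this
  exact eq_neg_of_add_eq_zero_right this

end LocalOneParameterSubgroups

section OneParameterSubgroups

variable {E : Type*} [NormedAddCommGroup E] [NormedSpace ℝ E]
  {G : Type*} [TopologicalSpace G] [ChartedSpace E G] [Group G]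

theorem IsOneParameterSubgroup.apply_zero {X : GroupLieAlgebra 𝓘(ℝ, E) G} {γ : ℝ → G}
    (h : IsOneParameterSubgroup X γ) : γ 0 = 1 := by
  have := h.2.1 0 0
  simpa using this

theorem IsOneParameterSubgroup.hasMFDerivAt_zero {X : GroupLieAlgebra 𝓘(ℝ, E) G} {γ : ℝ → G}
    (h : IsOneParameterSubgroup X γ) :
    HasMFDerivAt 𝓘(ℝ, ℝ) 𝓘(ℝ, E) γ 0 ((1 : ℝ →L[ℝ] ℝ).smulRight (X : E)) := by
  refine (h.1.mdifferentiable (by simp) 0).hasMFDerivAt.congr_mfderiv ?_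
  have h1 : ∀ A : ℝ →L[ℝ] E, A = (1 : ℝ →L[ℝ] ℝ).smulRight (A 1) := fun A => by ext; simp
  have h2 : (mfderiv 𝓘(ℝ, ℝ) 𝓘(ℝ, E) γ 0 (1 : ℝ) : E) = X := h.2.2
  rw [← h2]
  exact h1 _

theorem IsOneParameterSubgroup.comp_mul {X : GroupLieAlgebra 𝓘(ℝ, E) G}
    {γ : ℝ → G} (hγ : IsOneParameterSubgroup X γ) (c : ℝ) :
    IsOneParameterSubgroup (c • X) (fun t => γ (c * t)) := by
  have hm : HasFDerivAt (fun t : ℝ => c * t) ((1 : ℝ →L[ℝ] ℝ).smulRight c) 0 := by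
    refine ((hasDerivAt_id (0 : ℝ)).const_mul c).hasFDerivAt.congr_fderiv ?_
    ext; simp
  refine ⟨hγ.1.comp (contDiff_const.mul contDiff_id).contMDiff,
    fun s t => (congrArg γ (mul_add c s t)).trans (hγ.2.1 _ _), ?_⟩
  have h0 : HasMFDerivAt 𝓘(ℝ, ℝ) 𝓘(ℝ, E) γ (c * 0) ((1 : ℝ →L[ℝ] ℝ).smulRight (X : E)) := by
    rw [mul_zero]; exact hγ.hasMFDerivAt_zero
  have h1 := (HasMFDerivAt.comp (0 : ℝ) h0 hm.hasMFDerivAt).mfderiv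
  have h2 : (((1 : ℝ →L[ℝ] ℝ).smulRight (X : E)).comp ((1 : ℝ →L[ℝ] ℝ).smulRight c)) 1 =
    c • (X : E) := by simp
  exact (congrArg (fun A : ℝ →L[ℝ] E => A 1) h1).trans h2

variable [LieGroup 𝓘(ℝ, E) ∞ G]

/-- Left translation by `γ t` carries the velocity at `0` to the velocity at `t`. -/
theorem IsOneParameterSubgroup.isMIntegralCurve {X : GroupLieAlgebra 𝓘(ℝ, E) G} {γ : ℝ → G}
    (h : IsOneParameterSubgroup X γ) :
    IsMIntegralCurve γ (fun g : G => mulInvariantVectorField (I := 𝓘(ℝ, E)) X g) := by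
  intro t
  have hL : HasMFDerivAt 𝓘(ℝ, E) 𝓘(ℝ, E) (fun y : G => γ t * y) (γ 0)
      (mfderiv 𝓘(ℝ, E) 𝓘(ℝ, E) (fun y : G => γ t * y) 1 : E →L[ℝ] E) := by
    rw [h.apply_zero]
    exact ((contMDiff_mul_left (I := 𝓘(ℝ, E)) (n := ∞) (a := γ t)).mdifferentiable
      (by simp) 1).hasMFDerivAt
  have h1 : HasMFDerivAt 𝓘(ℝ, ℝ) 𝓘(ℝ, E) (fun s => γ t * γ s) 0
      ((1 : ℝ →L[ℝ] ℝ).smulRight (mulInvariantVectorField (I := 𝓘(ℝ, E)) X (γ t) : E)) :=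
    (HasMFDerivAt.comp (0 : ℝ) hL h.hasMFDerivAt_zero).congr_mfderiv
      (ContinuousLinearMap.comp_one_smulRight (V := E) (W := E) _ _)
  have h2 : γ = fun s => (fun s => γ t * γ s) (-t + s) := by
    ext s; simp [← h.2.1]
  have h3 : HasMFDerivAt 𝓘(ℝ, ℝ) 𝓘(ℝ, E) (fun s => γ t * γ s) (-t + t)
      ((1 : ℝ →L[ℝ] ℝ).smulRight (mulInvariantVectorField (I := 𝓘(ℝ, E)) X (γ t) : E)) := by
    rw [neg_add_cancel]; exact h1
  have h4 := hasMFDerivAt_comp_add (-t) t h3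
  rw [← h2] at h4
  exact h4

theorem IsOneParameterSubgroup.unique [T2Space G] {X : GroupLieAlgebra 𝓘(ℝ, E) G}
    {γ δ : ℝ → G} (hγ : IsOneParameterSubgroup X γ) (hδ : IsOneParameterSubgroup X δ) : γ = δ :=
  isMIntegralCurve_Ioo_eq_of_contMDiff_boundaryless (t₀ := 0)
    (contMDiff_mulInvariantVectorField_one (E := E) X) hγ.isMIntegralCurve hδ.isMIntegralCurve
    (by rw [hγ.apply_zero, hδ.apply_zero])

theorem IsOneParameterSubgroup.lieExp_eq [T2Space G] {X : GroupLieAlgebra 𝓘(ℝ, E) G}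
    {γ : ℝ → G} (hγ : IsOneParameterSubgroup X γ) : lieExp X = γ 1 := by
  have h : ∃ γ : ℝ → G, IsOneParameterSubgroup X γ := ⟨γ, hγ⟩
  rw [lieExp, dif_pos h, h.choose_spec.unique hγ]

/-- If `[X, Y] = 0` then `Ad` of the one-parameter subgroup of `X` fixes `Y`. -/
theorem IsOneParameterSubgroup.modelAd_apply_eq {X : GroupLieAlgebra 𝓘(ℝ, E) G}
    {γ : ℝ → G} (hγ : IsOneParameterSubgroup X γ) {Y : E} (h : modelBracket E G X Y = 0) (t : ℝ) :
    modelAd (γ t) Y = Y := by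
  have hd0 := (hasDerivAt_modelAd_comp hγ.apply_zero hγ.hasMFDerivAt_zero).clm_apply
    (hasDerivAt_const (0 : ℝ) Y)
  have hd : ∀ s, HasDerivAt (fun r => modelAd (γ r) Y) 0 s := by
    intro s
    have h1 : HasDerivAt (fun r => modelAd (γ (-s + r)) Y) 0 s := by
      refine HasDerivAt.comp_const_add (f := fun r => modelAd (γ r) Y) (-s) s ?_
      rw [neg_add_cancel]
      exact hd0.congr_deriv (by simp [h])
    have h2 : HasDerivAt (fun r => modelAd (γ s) (modelAd (γ (-s + r)) Y)) (modelAd (γ s) 0) s :=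
      (modelAd (γ s) : E →L[ℝ] E).hasFDerivAt.comp_hasDerivAt s h1
    have h3 : (fun r => modelAd (γ s) (modelAd (γ (-s + r)) Y)) = fun r => modelAd (γ r) Y := by
      ext r
      rw [← ContinuousLinearMap.comp_apply, ← modelAd_mul, ← hγ.2.1, add_neg_cancel_left]
    rw [h3, map_zero] at h2
    exact h2
  have h1 : modelAd (γ t) Y = modelAd (γ 0) Y := is_const_of_deriv_eq_zero
    (f := fun r => modelAd (γ r) Y) (fun s => (hd s).differentiableAt) (fun s => (hd s).deriv) t 0
  have h0 : γ 0 = 1 := hγ.apply_zero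
  rw [h1, h0, modelAd_one]
  rfl

end OneParameterSubgroups

/-! ### Real reductive groups -/

section Reductive

variable {E : Type*} [NormedAddCommGroup E] [NormedSpace ℝ E]
  {G : Type*} [TopologicalSpace G] [ChartedSpace E G] [Group G]

namespace RealReductive

/-- The differential `θ` of the Cartan involution, as an endomorphism of the model space. -/
def modelTheta (R : RealReductive E G) : E →L[ℝ] E := lieDiff R.Θ

/-- The invariant form `b`, as a continuous bilinear form on the model space. -/
def modelForm [FiniteDimensional ℝ E] (R : RealReductive E G) : E →L[ℝ] E →L[ℝ] ℝ :=
  LinearMap.toContinuousBilinearMap (E := E) (F := E) (G := ℝ) R.b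

theorem hasMFDerivAt_theta (R : RealReductive E G) :
    HasMFDerivAt 𝓘(ℝ, E) 𝓘(ℝ, E) R.Θ 1 R.modelTheta :=
  (R.smooth_Θ.mdifferentiable (by simp) 1).hasMFDerivAt

theorem modelTheta_modelTheta (R : RealReductive E G) (X : E) :
    R.modelTheta (R.modelTheta X) = X := by
  have h1 : HasMFDerivAt 𝓘(ℝ, E) 𝓘(ℝ, E) R.Θ (R.Θ 1) R.modelTheta := by
    rw [map_one]; exact R.hasMFDerivAt_theta
  have h2 := HasMFDerivAt.comp (1 : G) h1 R.hasMFDerivAt_theta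
  have h3 : R.Θ ∘ R.Θ = id := by ext g; exact R.involutive_Θ g
  rw [h3] at h2
  exact congrArg (fun A : E →L[ℝ] E => A X) (hasMFDerivAt_unique h2 (hasMFDerivAt_id (1 : G)))

section Form

variable [FiniteDimensional ℝ E] (R : RealReductive E G)

theorem modelForm_symm (X Y : E) : R.modelForm X Y = R.modelForm Y X := R.symm_b X Y

theorem modelForm_modelAd (g : G) (X Y : E) :
    R.modelForm (modelAd g X) (modelAd g Y) = R.modelForm X Y := R.invariant_b g X Y

theorem modelForm_modelTheta (X Y : E) :
    R.modelForm (R.modelTheta X) (R.modelTheta Y) = R.modelForm X Y := R.theta_b X Y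

theorem modelForm_modelTheta_right (X Y : E) :
    R.modelForm X (R.modelTheta Y) = R.modelForm (R.modelTheta X) Y := by
  rw [← R.modelForm_modelTheta X, R.modelTheta_modelTheta]

theorem modelForm_theta_neg {X : E} (hX : X ≠ 0) : R.modelForm X (R.modelTheta X) < 0 := by
  have : 0 < -R.modelForm X (R.modelTheta X) := R.pos_b X hX
  linarith

theorem eq_zero_of_modelForm_theta_nonneg {X : E} (h : 0 ≤ R.modelForm X (R.modelTheta X)) :
    X = 0 := by
  by_contra h0
  exact absurd (R.modelForm_theta_neg h0) (not_lt.2 h)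

theorem eq_zero_of_modelForm_eq_zero {X : E} (h : ∀ Y, R.modelForm X Y = 0) : X = 0 :=
  R.eq_zero_of_modelForm_theta_nonneg (h _).ge

end Form

theorem mem_𝔭_iff (R : RealReductive E G) (X : E) : X ∈ R.𝔭 ↔ R.modelTheta X = -X := by
  have h : X ∈ R.𝔭 ↔ R.modelTheta X = (-1 : ℝ) • X :=
    Module.End.mem_eigenspace_iff (M := GroupLieAlgebra 𝓘(ℝ, E) G) (x := X)
  rwa [neg_one_smul] at h

theorem mem_𝔨_iff (R : RealReductive E G) (X : E) : X ∈ R.𝔨 ↔ R.modelTheta X = X := by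
  have h : X ∈ R.𝔨 ↔ R.modelTheta X = (1 : ℝ) • X :=
    Module.End.mem_eigenspace_iff (M := GroupLieAlgebra 𝓘(ℝ, E) G) (x := X)
  rwa [one_smul] at h

section Bracket

variable [LieGroup 𝓘(ℝ, E) ∞ G]

theorem modelTheta_modelAd (R : RealReductive E G) (g : G) (X : E) :
    R.modelTheta (modelAd g X) = modelAd (R.Θ g) (R.modelTheta X) := by
  have hc : R.Θ ∘ (fun x : G => g * x * g⁻¹) =
      (fun x : G => R.Θ g * x * (R.Θ g)⁻¹) ∘ R.Θ := by
    ext x; simp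
  have h1 : HasMFDerivAt 𝓘(ℝ, E) 𝓘(ℝ, E) R.Θ (g * 1 * g⁻¹) R.modelTheta := by
    rw [show (g * 1 * g⁻¹ : G) = 1 by simp]; exact R.hasMFDerivAt_theta
  have h2 : HasMFDerivAt 𝓘(ℝ, E) 𝓘(ℝ, E) (fun x : G => R.Θ g * x * (R.Θ g)⁻¹) (R.Θ 1)
      (modelAd (R.Θ g) : E →L[ℝ] E) := by
    rw [map_one]; exact hasMFDerivAt_conj (E := E) _
  have h3 := HasMFDerivAt.comp (1 : G) h1 (hasMFDerivAt_conj (E := E) g)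
  rw [hc] at h3
  exact congrArg (fun A : E →L[ℝ] E => A X)
    (hasMFDerivAt_unique h3 (HasMFDerivAt.comp (1 : G) h2 R.hasMFDerivAt_theta))

variable [FiniteDimensional ℝ E] [T2Space G]

theorem modelTheta_modelBracket (R : RealReductive E G) (X Y : E) :
    R.modelTheta (modelBracket E G X Y) =
      modelBracket E G (R.modelTheta X) (R.modelTheta Y) := by
  have := FiniteDimensional.complete ℝ E
  obtain ⟨γ, ε, -, h0, hγ, -⟩ := exists_local_oneParameterSubgroup (G := G) X
  have h1 : HasMFDerivAt 𝓘(ℝ, E) 𝓘(ℝ, E) R.Θ (γ 0) R.modelTheta := by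
    rw [h0]; exact R.hasMFDerivAt_theta
  have hδ : HasMFDerivAt 𝓘(ℝ, ℝ) 𝓘(ℝ, E) (R.Θ ∘ γ) 0
      ((1 : ℝ →L[ℝ] ℝ).smulRight (R.modelTheta X)) :=
    (HasMFDerivAt.comp (0 : ℝ) h1 hγ).congr_mfderiv
      (ContinuousLinearMap.comp_one_smulRight (V := E) (W := E) _ _)
  have d1 := (hasDerivAt_modelAd_comp h0 hγ).clm_apply (hasDerivAt_const (0 : ℝ) Y)
  have d2 := (hasDerivAt_modelAd_comp (by simp [h0]) hδ).clm_apply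
    (hasDerivAt_const (0 : ℝ) (R.modelTheta Y))
  have d3 := R.modelTheta.hasFDerivAt.comp_hasDerivAt 0 d1
  have hc : (R.modelTheta ∘ fun t => modelAd (γ t) Y) =
      fun t => modelAd ((R.Θ ∘ γ) t) (R.modelTheta Y) := by
    ext t; exact R.modelTheta_modelAd _ _
  rw [hc] at d3
  simpa using d3.unique d2

/-- The form `b` is invariant under the adjoint action of the Lie algebra. -/
theorem modelForm_modelBracket (R : RealReductive E G) (Z X Y : E) :
    R.modelForm (modelBracket E G Z X) Y = -R.modelForm X (modelBracket E G Z Y) := by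
  have := FiniteDimensional.complete ℝ E
  obtain ⟨γ, ε, -, h0, hγ, -⟩ := exists_local_oneParameterSubgroup (G := G) Z
  have hd := hasDerivAt_modelAd_comp h0 hγ
  have d1 := hd.clm_apply (hasDerivAt_const (0 : ℝ) X)
  have d2 := hd.clm_apply (hasDerivAt_const (0 : ℝ) Y)
  have d3 := (R.modelForm.hasFDerivAt.comp_hasDerivAt 0 d1).clm_apply d2
  have hc : (fun t => (R.modelForm ∘ fun t => modelAd (γ t) X) t (modelAd (γ t) Y)) =
      fun _ => R.modelForm X Y := by
    ext t; exact R.modelForm_modelAd _ _ _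
  rw [hc] at d3
  have := d3.unique (hasDerivAt_const (0 : ℝ) _)
  simp only [Function.comp, h0, modelAd_one, map_zero, add_zero,
    ContinuousLinearMap.id_apply] at this
  linarith

end Bracket

section Escape

/-- Every element of `𝔭` generates a one-parameter subgroup: `lieExp` is injective on `𝔭` by the
Cartan decomposition, whereas it would take its default value `1` at `X` and at `2X` if there were
no one-parameter subgroup with velocity `X`. -/
theorem exists_oneParameterSubgroup (R : RealReductive E G) {X : E} (hX : X ∈ R.𝔭) (h0 : X ≠ 0) :
    ∃ γ : ℝ → G, IsOneParameterSubgroup (X : GroupLieAlgebra 𝓘(ℝ, E) G) γ := by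
  by_contra hne
  have hne2 : ¬ ∃ γ : ℝ → G,
      IsOneParameterSubgroup ((2 : ℝ) • X : GroupLieAlgebra 𝓘(ℝ, E) G) γ := by
    rintro ⟨γ, hγ⟩
    have h1 := hγ.comp_mul (1 / 2)
    have h2 : ((1 / 2 : ℝ) • ((2 : ℝ) • X : GroupLieAlgebra 𝓘(ℝ, E) G)) = X := by
      rw [smul_smul]; norm_num
    exact hne ⟨_, h1.1, h1.2.1, h1.2.2.trans h2⟩
  have e1 : lieExp (X : GroupLieAlgebra 𝓘(ℝ, E) G) = (1 : G) := dif_neg hne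
  have e2 : lieExp ((2 : ℝ) • X : GroupLieAlgebra 𝓘(ℝ, E) G) = (1 : G) := dif_neg hne2
  have hinj := R.cartan_decomposition.injective
  have h3 := @hinj (1, ⟨X, hX⟩) (1, ⟨(2 : ℝ) • X, R.𝔭.smul_mem 2 hX⟩)
    (congrArg (fun g : G => 1 * g) (e1.trans e2.symm))
  have h4 : X = (2 : ℝ) • X := congrArg Subtype.val (congrArg Prod.snd h3)
  rw [two_smul] at h4
  exact h0 (by simpa using h4)

variable [LieGroup 𝓘(ℝ, E) ∞ G] [T2Space G]

/-- By the Cartan decomposition, the one-parameter subgroup generated by a nonzero element of `𝔭`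
leaves every compact set. -/
theorem eq_zero_of_oneParameterSubgroup_mem_compact (R : RealReductive E G) {X : E}
    (hX : X ∈ R.𝔭) {γ : ℝ → G}
    (hγ : IsOneParameterSubgroup (X : GroupLieAlgebra 𝓘(ℝ, E) G) γ) {C : Set G}
    (hC : IsCompact C) (hγC : ∀ t, γ t ∈ C) : X = 0 := by
  by_contra h0
  let c := R.cartan_decomposition.homeomorph
  have hK := (hC.image c.symm.continuous).image (continuous_subtype_val.comp continuous_snd)
  have hmem : ∀ t : ℝ, t • X ∈ (fun p : fixedSubgroup R.Θ × antiFixedPart (E := E) R.Θ =>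
      ((p.2 : GroupLieAlgebra 𝓘(ℝ, E) G) : E)) '' (c.symm '' C) := by
    intro t
    have h1 : lieExp (t • X : GroupLieAlgebra 𝓘(ℝ, E) G) = γ t :=
      (hγ.comp_mul t).lieExp_eq.trans (congrArg γ (mul_one t))
    refine ⟨(1, ⟨t • X, R.𝔭.smul_mem t hX⟩), ⟨γ t, hγC t, ?_⟩, rfl⟩
    rw [c.symm_apply_eq]
    exact (h1.symm.trans (one_mul _).symm)
  have hK' : IsCompact (X := E) ((fun p : fixedSubgroup R.Θ × antiFixedPart (E := E) R.Θ =>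
      ((p.2 : GroupLieAlgebra 𝓘(ℝ, E) G) : E)) '' (c.symm '' C)) := hK
  obtain ⟨r, hr⟩ := hK'.isBounded.exists_norm_le
  have hpos : 0 < ‖X‖ := norm_pos_iff.2 h0
  have h2 := hr _ (hmem ((|r| + 1) / ‖X‖))
  rw [norm_smul, norm_div, norm_norm, div_mul_cancel₀ _ hpos.ne', Real.norm_of_nonneg
    (by positivity)] at h2
  linarith [le_abs_self r]

end Escape

end RealReductive

end Reductive

/-! ### Duality and the squared norms -/

section Duality

variable {E : Type*} [NormedAddCommGroup E] [NormedSpace ℝ E]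
  {G : Type*} [TopologicalSpace G] [ChartedSpace E G] [Group G]

namespace RealReductive

variable (R : RealReductive E G)

/-- The component in `𝔨`. -/
def projK : E →L[ℝ] E := (1 / 2 : ℝ) • (ContinuousLinearMap.id ℝ E + R.modelTheta)

/-- The component in `𝔭`. -/
def projP : E →L[ℝ] E := (1 / 2 : ℝ) • (ContinuousLinearMap.id ℝ E - R.modelTheta)

theorem projK_apply (X : E) : R.projK X = (1 / 2 : ℝ) • (X + R.modelTheta X) := rfl

theorem projP_apply (X : E) : R.projP X = (1 / 2 : ℝ) • (X - R.modelTheta X) := rfl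

theorem modelTheta_projK (X : E) : R.modelTheta (R.projK X) = R.projK X := by
  rw [projK_apply, map_smul, map_add, R.modelTheta_modelTheta, add_comm]

theorem modelTheta_projP (X : E) : R.modelTheta (R.projP X) = -R.projP X := by
  rw [projP_apply, map_smul, map_sub, R.modelTheta_modelTheta, ← smul_neg, neg_sub]

theorem projK_add_projP (X : E) : R.projK X + R.projP X = X := by
  rw [projK_apply, projP_apply]
  module

theorem modelTheta_eq (X : E) : R.modelTheta X = R.projK X - R.projP X := by
  rw [projK_apply, projP_apply]
  module

variable [FiniteDimensional ℝ E]

/-- The vector dual to a linear form with respect to the scalar product `-b(X, θ Y)`. -/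
def sharp : (E →L[ℝ] ℝ) →L[ℝ] E :=
  LinearMap.toContinuousLinearMap
    ((R.scalar.toDual (bilinForm_nondegenerate_of_pos _ R.scalar_pos)).symm.toLinearMap ∘ₗ
      (ContinuousLinearMap.coeLM ℝ : (E →L[ℝ] ℝ) →ₗ[ℝ] (E →ₗ[ℝ] ℝ)) : (E →L[ℝ] ℝ) →ₗ[ℝ] E)

theorem modelForm_sharp (α : E →L[ℝ] ℝ) (X : E) :
    -R.modelForm (R.sharp α) (R.modelTheta X) = α X :=
  LinearMap.BilinForm.apply_toDual_symm_apply
    (hB := bilinForm_nondegenerate_of_pos _ R.scalar_pos) (α : Module.Dual ℝ E) X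

/-- The vector dual to a linear form with respect to the invariant form `b`. -/
def sharpForm : (E →L[ℝ] ℝ) →L[ℝ] E := -(R.modelTheta.comp R.sharp)

theorem sharpForm_apply (α : E →L[ℝ] ℝ) : R.sharpForm α = -R.modelTheta (R.sharp α) := rfl

theorem modelForm_sharpForm (α : E →L[ℝ] ℝ) (X : E) : R.modelForm (R.sharpForm α) X = α X := by
  rw [sharpForm_apply, map_neg, neg_apply, ← R.modelForm_modelTheta_right,
    R.modelForm_sharp]

theorem modelForm_eq_zero {X Y : E} (hX : R.modelTheta X = X) (hY : R.modelTheta Y = -Y) :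
    R.modelForm X Y = 0 := by
  have := R.modelForm_modelTheta X Y
  rw [hX, hY, map_neg] at this
  linarith

theorem apply_eq_of_theta_eq (α : E →L[ℝ] ℝ) {X : E} (hX : R.modelTheta X = X) :
    α X = -R.modelForm (R.projK (R.sharp α)) X := by
  have h := R.modelForm_sharp α X
  rw [hX] at h
  have h2 := congrArg (fun Y => R.modelForm Y X) (R.projK_add_projP (R.sharp α))
  simp only [map_add, add_apply] at h2
  rw [R.modelForm_symm (R.projP _), R.modelForm_eq_zero hX (R.modelTheta_projP _)] at h2
  linarith

theorem apply_eq_of_theta_eq_neg (α : E →L[ℝ] ℝ) {X : E} (hX : R.modelTheta X = -X) :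
    α X = R.modelForm (R.projP (R.sharp α)) X := by
  have h := R.modelForm_sharp α X
  rw [hX, map_neg] at h
  have h2 := congrArg (fun Y => R.modelForm Y X) (R.projK_add_projP (R.sharp α))
  simp only [map_add, add_apply] at h2
  rw [R.modelForm_eq_zero (R.modelTheta_projK _) hX] at h2
  linarith

theorem normSq_eq (α : E →L[ℝ] ℝ) :
    R.normSq (α : StrongDual ℝ (GroupLieAlgebra 𝓘(ℝ, E) G)) =
      -R.modelForm (R.sharp α) (R.modelTheta (R.sharp α)) := rfl

theorem normSqK_eq (α : E →L[ℝ] ℝ) :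
    R.normSqK ((α : StrongDual ℝ (GroupLieAlgebra 𝓘(ℝ, E) G)).comp R.𝔨.subtypeL) =
      -R.modelForm (R.projK (R.sharp α)) (R.projK (R.sharp α)) := by
  have hmem : R.projK (R.sharp α) ∈ R.𝔨 := (R.mem_𝔨_iff _).2 (R.modelTheta_projK _)
  have hB : (R.scalar.restrict R.𝔨).Nondegenerate :=
    bilinForm_nondegenerate_of_pos _ fun X hX => R.scalar_pos X (fun h => hX (Subtype.ext h))
  have h1 : ((R.scalar.restrict R.𝔨).toDual hB).symm
      ((α : StrongDual ℝ (GroupLieAlgebra 𝓘(ℝ, E) G)).comp R.𝔨.subtypeL).toLinearMap =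
      ⟨R.projK (R.sharp α), hmem⟩ := by
    rw [LinearEquiv.symm_apply_eq]
    ext Y
    have hY : R.modelTheta Y.1 = Y.1 := (R.mem_𝔨_iff _).1 Y.2
    refine (R.apply_eq_of_theta_eq α hY).trans ?_
    exact congrArg (fun Z => -R.modelForm (R.projK (R.sharp α)) Z) hY.symm
  have h3 : R.normSqK ((α : StrongDual ℝ (GroupLieAlgebra 𝓘(ℝ, E) G)).comp R.𝔨.subtypeL) =
      R.scalar.restrict R.𝔨 ⟨R.projK (R.sharp α), hmem⟩ ⟨R.projK (R.sharp α), hmem⟩ := by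
    rw [← h1]; rfl
  rw [h3]
  exact congrArg (fun Z => -R.modelForm (R.projK (R.sharp α)) Z) (R.modelTheta_projK _)

/-- `𝔨` and `𝔭` are orthogonal for the scalar product. -/
theorem normSq_eq_add (α : E →L[ℝ] ℝ) :
    R.normSq (α : StrongDual ℝ (GroupLieAlgebra 𝓘(ℝ, E) G)) =
      R.normSqK ((α : StrongDual ℝ (GroupLieAlgebra 𝓘(ℝ, E) G)).comp R.𝔨.subtypeL) +
        R.modelForm (R.projP (R.sharp α)) (R.projP (R.sharp α)) := by
  rw [normSq_eq, normSqK_eq, R.modelTheta_eq]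
  nth_rewrite 1 [← R.projK_add_projP (R.sharp α)]
  have h := R.modelForm_eq_zero (R.modelTheta_projK (R.sharp α)) (R.modelTheta_projP (R.sharp α))
  simp only [map_add, map_sub, add_apply, R.modelForm_symm (R.projP _) (R.projK _), h]
  ring

/-- The invariant form at a linear form is the difference of the squared norms of its `𝔨`- and
`𝔭`-components. -/
theorem neg_modelForm_sharpForm (α : E →L[ℝ] ℝ) :
    -R.modelForm (R.sharpForm α) (R.sharpForm α) =
      R.normSqK ((α : StrongDual ℝ (GroupLieAlgebra 𝓘(ℝ, E) G)).comp R.𝔨.subtypeL) -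
        R.modelForm (R.projP (R.sharp α)) (R.projP (R.sharp α)) := by
  rw [normSqK_eq, sharpForm_apply, map_neg, map_neg, neg_apply, neg_neg,
    R.modelForm_modelTheta]
  nth_rewrite 1 2 [← R.projK_add_projP (R.sharp α)]
  have h := R.modelForm_eq_zero (R.modelTheta_projK (R.sharp α)) (R.modelTheta_projP (R.sharp α))
  simp only [map_add, add_apply, R.modelForm_symm (R.projP _) (R.projK _), h]
  ring

theorem normSqK_nonneg (α : E →L[ℝ] ℝ) :
    0 ≤ R.normSqK ((α : StrongDual ℝ (GroupLieAlgebra 𝓘(ℝ, E) G)).comp R.𝔨.subtypeL) := by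
  rw [normSqK_eq]
  by_cases h : R.projK (R.sharp α) = 0
  · simp [h]
  · have := R.modelForm_theta_neg h
    rw [modelTheta_projK] at this
    linarith

theorem mem_slice_iff {M : Type*} (Φ : M → StrongDual ℝ (GroupLieAlgebra 𝓘(ℝ, E) G))
    (m : M) : m ∈ R.slice Φ ↔ R.projP (R.sharp (Φ m)) = 0 := by
  have hval : ∀ X : E, X ∈ R.𝔭 →
      (Φ m : E →L[ℝ] ℝ) X = R.modelForm (R.projP (R.sharp (Φ m))) X :=
    fun X hX => R.apply_eq_of_theta_eq_neg _ ((R.mem_𝔭_iff X).1 hX)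
  constructor
  · intro h
    have hmem : R.projP (R.sharp (Φ m)) ∈ R.𝔭 := (R.mem_𝔭_iff _).2 (R.modelTheta_projP _)
    have h1 : (Φ m : E →L[ℝ] ℝ) (R.projP (R.sharp (Φ m))) = 0 :=
      congrArg (fun A : StrongDual ℝ R.𝔭 => A ⟨_, hmem⟩) (show R.momentP Φ m = 0 from h)
    have h2 := (hval _ hmem).symm.trans h1
    refine R.eq_zero_of_modelForm_theta_nonneg ?_
    rw [R.modelTheta_projP, map_neg, h2, neg_zero]
  · intro h
    change R.momentP Φ m = 0
    ext X
    refine (hval X.1 X.2).trans ?_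
    rw [h, map_zero]
    rfl

end RealReductive

end Duality

/-! ### Infinitesimal action and moment map -/

section HamiltonianAction

theorem ContinuousAlternatingMap.map_neg_left {V : Type*} [AddCommGroup V] [Module ℝ V]
    [TopologicalSpace V] (A : V [⋀^Fin 2]→L[ℝ] ℝ) (u v : V) : A ![-u, v] = -A ![u, v] := by
  have h := A.map_update_smul ![u, v] 0 (-1) u
  have hw : ∀ w : V, Function.update ![u, v] 0 w = ![w, v] := fun w => by
    ext i; fin_cases i <;> rfl
  rwa [hw, hw, neg_one_smul, neg_one_smul] at h

variable {E : Type*} [NormedAddCommGroup E] [NormedSpace ℝ E]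
  {G : Type*} [TopologicalSpace G] [ChartedSpace E G] [Group G]
  {F : Type*} [NormedAddCommGroup F] [NormedSpace ℝ F]
  {M : Type*} [TopologicalSpace M] [ChartedSpace F M]

/-- A moment map, with its values seen as linear forms on the model space. -/
def modelMoment (Φ : M → StrongDual ℝ (GroupLieAlgebra 𝓘(ℝ, E) G)) (m : M) : E →L[ℝ] ℝ := Φ m

variable (F) in
/-- The differential of a moment map. -/
def modelMomentDeriv (Φ : M → StrongDual ℝ (GroupLieAlgebra 𝓘(ℝ, E) G)) (m : M) :
    F →L[ℝ] E →L[ℝ] ℝ :=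
  mfderiv 𝓘(ℝ, F) 𝓘(ℝ, E →L[ℝ] ℝ) (modelMoment Φ) m

variable (E G F) in
/-- The differential at `1` of the orbit map `g ↦ g • m`. -/
def orbitDeriv [MulAction G M] (m : M) : E →L[ℝ] F :=
  mfderiv 𝓘(ℝ, E) 𝓘(ℝ, F) (fun g : G => g • m) 1

variable [MulAction G M]
  {Ω : ∀ m : M, TangentSpace 𝓘(ℝ, F) m [⋀^Fin 2]→L[ℝ] ℝ}
  {Φ : M → StrongDual ℝ (GroupLieAlgebra 𝓘(ℝ, E) G)}

namespace IsHamiltonian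

theorem mdifferentiable_smul (h : IsHamiltonian Ω Φ) (m : M) (g : G) :
    MDifferentiableAt 𝓘(ℝ, E) 𝓘(ℝ, F) (fun g : G => g • m) g :=
  (h.smooth_action.comp (contMDiff_id.prodMk contMDiff_const)).mdifferentiable (by simp) g

variable [FiniteDimensional ℝ E]

theorem contMDiff_modelMoment (h : IsHamiltonian Ω Φ) :
    ContMDiff 𝓘(ℝ, F) 𝓘(ℝ, E →L[ℝ] ℝ) ∞ (modelMoment Φ) := by
  let e := Module.finBasis ℝ E
  have h1 : ContMDiff 𝓘(ℝ, F) 𝓘(ℝ, Fin (Module.finrank ℝ E) → ℝ) ∞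
      (fun m i => modelMoment Φ m (e i)) := contMDiff_pi_space.2 fun i => h.smooth_moment (e i)
  let A : (Fin (Module.finrank ℝ E) → ℝ) →L[ℝ] (E →L[ℝ] ℝ) :=
    ∑ i, (ContinuousLinearMap.proj i).smulRight
      (LinearMap.toContinuousLinearMap (e.coord i))
  have h2 : modelMoment Φ = A ∘ fun m i => modelMoment Φ m (e i) := by
    ext m X
    have hX := congrArg (modelMoment Φ m) (e.sum_repr X)
    rw [map_sum] at hX
    rw [← hX]
    simp [A, mul_comm]
  rw [h2]
  exact A.contDiff.contMDiff.comp h1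

theorem hasMFDerivAt_modelMoment (h : IsHamiltonian Ω Φ) (m : M) :
    HasMFDerivAt 𝓘(ℝ, F) 𝓘(ℝ, E →L[ℝ] ℝ) (modelMoment Φ) m (modelMomentDeriv F Φ m) :=
  (h.contMDiff_modelMoment.mdifferentiable (by simp) m).hasMFDerivAt

theorem mfderiv_modelMoment_apply (h : IsHamiltonian Ω Φ) (X : E) (m : M) (v : F) :
    (mfderiv 𝓘(ℝ, F) 𝓘(ℝ, ℝ) (fun x => modelMoment Φ x X) m v : ℝ) =
      modelMomentDeriv F Φ m v X := by
  have h1 : HasMFDerivAt 𝓘(ℝ, E →L[ℝ] ℝ) 𝓘(ℝ, ℝ) (fun α : E →L[ℝ] ℝ => α X)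
      (modelMoment Φ m) (ContinuousLinearMap.apply ℝ ℝ X) :=
    (ContinuousLinearMap.apply ℝ ℝ X).hasFDerivAt.hasMFDerivAt
  exact congrArg (fun A : F →L[ℝ] ℝ => A v)
    (HasMFDerivAt.comp m h1 (h.hasMFDerivAt_modelMoment m)).mfderiv

/-- The moment map equation; the sign disappears because `X_M` is minus the derivative of the orbit
map. -/
theorem form_orbitDeriv (h : IsHamiltonian Ω Φ) (X : E) (m : M) (v : F) :
    Ω m ![(orbitDeriv E G F m X : F), v] = modelMomentDeriv F Φ m v X := by
  exact neg_injective
    ((ContinuousAlternatingMap.map_neg_left (Ω m) (orbitDeriv E G F m X) v).symm.trans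
      ((h.moment X m v).trans (congrArg Neg.neg (h.mfderiv_modelMoment_apply X m v))))

/-- The kernel of `dΦ^X` is the symplectic orthogonal of `X_M`, so `X_M` vanishes at the critical
points of `Φ^X`. -/
theorem orbitDeriv_eq_zero (h : IsHamiltonian Ω Φ) {X : E} {m : M}
    (h0 : ∀ v : F, modelMomentDeriv F Φ m v X = 0) : orbitDeriv E G F m X = 0 :=
  h.symplectic.nondegenerate m _ fun w => (h.form_orbitDeriv X m w).trans (h0 w)

variable [LieGroup 𝓘(ℝ, E) ∞ G]

/-- Equivariance of the moment map, in terms of dual vectors for the invariant form. -/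
theorem sharpForm_smul (h : IsHamiltonian Ω Φ) (R : RealReductive E G) (g : G) (m : M) :
    R.sharpForm (modelMoment Φ (g • m)) = modelAd g (R.sharpForm (modelMoment Φ m)) := by
  rw [← sub_eq_zero]
  refine R.eq_zero_of_modelForm_eq_zero fun Y => ?_
  have hY : Y = modelAd g (modelAd g⁻¹ Y) := by
    rw [← ContinuousLinearMap.comp_apply, ← modelAd_mul, mul_inv_cancel, modelAd_one]
    rfl
  rw [hY, map_sub, sub_apply, R.modelForm_modelAd, R.modelForm_sharpForm,
    R.modelForm_sharpForm, sub_eq_zero]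
  exact h.equivariant g m _

/-- The infinitesimal form of equivariance. -/
theorem modelMomentDeriv_orbitDeriv [T2Space G] (h : IsHamiltonian Ω Φ) (R : RealReductive E G)
    (m : M) (Z X : E) :
    modelMomentDeriv F Φ m (orbitDeriv E G F m Z) X =
      R.modelForm (modelBracket E G Z (R.sharpForm (modelMoment Φ m))) X := by
  have := FiniteDimensional.complete ℝ E
  obtain ⟨γ, ε, -, h0, hγ, -⟩ := exists_local_oneParameterSubgroup (G := G) Z
  have d1 := (R.modelForm.hasFDerivAt.comp_hasDerivAt 0 ((hasDerivAt_modelAd_comp h0 hγ).clm_apply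
    (hasDerivAt_const (0 : ℝ) (R.sharpForm (modelMoment Φ m))))).clm_apply
      (hasDerivAt_const (0 : ℝ) X)
  have ho : HasMFDerivAt 𝓘(ℝ, E) 𝓘(ℝ, F) (fun g : G => g • m) (γ 0) (orbitDeriv E G F m) := by
    rw [h0]; exact (h.mdifferentiable_smul m 1).hasMFDerivAt
  have hM : HasMFDerivAt 𝓘(ℝ, F) 𝓘(ℝ, E →L[ℝ] ℝ) (modelMoment Φ) (γ 0 • m)
      (modelMomentDeriv F Φ m) := by
    rw [h0, one_smul]; exact h.hasMFDerivAt_modelMoment m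
  have d2 : HasFDerivAt (fun t => modelMoment Φ (γ t • m))
      (((modelMomentDeriv F Φ m).comp (orbitDeriv E G F m)).comp
        ((1 : ℝ →L[ℝ] ℝ).smulRight Z)) 0 :=
    (HasMFDerivAt.comp (0 : ℝ) (HasMFDerivAt.comp (γ 0) hM ho) hγ).hasFDerivAt
  have d3 := d2.hasDerivAt.clm_apply (hasDerivAt_const (0 : ℝ) X)
  have hc : (fun t => modelMoment Φ (γ t • m) X) =
      fun t => (R.modelForm ∘ fun t => modelAd (γ t) (R.sharpForm (modelMoment Φ m))) t X := by
    ext t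
    rw [Function.comp_apply, ← h.sharpForm_smul R, R.modelForm_sharpForm]
  rw [hc] at d3
  simpa using d3.unique d1

/-- If `dΦ^X` vanishes at `m`, then `X` stabilizes `m`, hence centralizes `Φ(m)`. -/
theorem modelBracket_eq_zero [T2Space G] (h : IsHamiltonian Ω Φ) (R : RealReductive E G)
    {X : E} {m : M} (h0 : ∀ v : F, modelMomentDeriv F Φ m v X = 0) :
    modelBracket E G X (R.sharpForm (modelMoment Φ m)) = 0 := by
  refine R.eq_zero_of_modelForm_eq_zero fun Y => ?_
  rw [← h.modelMomentDeriv_orbitDeriv R, h.orbitDeriv_eq_zero h0, map_zero]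
  rfl

/-- If `Φ` is proper, no nonzero element of `𝔭` centralizes a value `Φ(m)`: the one-parameter
subgroup it generates would move `m` within the fibre of `Φ` over `Φ(m)`, which is compact, and so
would be relatively compact because the action is proper. -/
theorem eq_zero_of_modelBracket_eq_zero [T2Space G] (h : IsHamiltonian Ω Φ)
    (R : RealReductive E G) (hG : IsProperAction G M) (hΦ : IsProperMap Φ) {X : E} {m : M}
    (hX : R.modelTheta X = -X) (h0 : modelBracket E G X (R.sharpForm (modelMoment Φ m)) = 0) :
    X = 0 := by
  by_contra hne
  have hX' := (R.mem_𝔭_iff X).2 hX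
  obtain ⟨γ, hγ⟩ := R.exists_oneParameterSubgroup hX' hne
  refine hne (R.eq_zero_of_oneParameterSubgroup_mem_compact hX' hγ
    (hG (Φ ⁻¹' {Φ m}) (hΦ.isCompact_preimage isCompact_singleton)) fun t => ⟨m, rfl, ?_⟩)
  have h1 : R.sharpForm (modelMoment Φ (γ t • m)) = R.sharpForm (modelMoment Φ m) := by
    rw [h.sharpForm_smul R, hγ.modelAd_apply_eq h0]
  have h2 : modelMoment Φ (γ t • m) = modelMoment Φ m := by
    ext Y
    rw [← R.modelForm_sharpForm, h1, R.modelForm_sharpForm]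
  exact h2

/-- The `𝔭`-component of `Φ(m)` vanishes as soon as it commutes with `Φ(m)`. -/
theorem mem_slice_of_modelBracket_eq_zero [T2Space G] (h : IsHamiltonian Ω Φ)
    (R : RealReductive E G) (hG : IsProperAction G M) (hΦ : IsProperMap Φ) {m : M}
    (h0 : modelBracket E G (R.projK (R.sharp (modelMoment Φ m)))
      (R.projP (R.sharp (modelMoment Φ m))) = 0) : m ∈ R.slice Φ := by
  have := FiniteDimensional.complete ℝ E
  refine (R.mem_slice_iff Φ m).2 (h.eq_zero_of_modelBracket_eq_zero R hG hΦ (m := m)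
    (R.modelTheta_projP _) ?_)
  change modelBracket E G (R.projP (R.sharp (modelMoment Φ m))) _ = 0
  rw [R.sharpForm_apply, R.modelTheta_eq, map_neg, map_sub, modelBracket_self, modelBracket_skew,
    h0]
  simp

end IsHamiltonian

end HamiltonianAction

/-! ### Critical points and orbits -/

section Analysis

theorem isCompact_sublevel_of_posDef {V : Type*} [NormedAddCommGroup V] [NormedSpace ℝ V]
    [FiniteDimensional ℝ V] {q : V → ℝ} (hq : Continuous q)
    (hsmul : ∀ (c : ℝ) (x : V), q (c • x) = c ^ 2 * q x) (hpos : ∀ x, x ≠ 0 → 0 < q x) (r : ℝ) :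
    IsCompact {x | q x ≤ r} := by
  have := FiniteDimensional.proper_real V
  obtain ⟨δ, hδ, hmin⟩ : ∃ δ > 0, ∀ x ∈ Metric.sphere (0 : V) 1, δ ≤ q x := by
    rcases (Metric.sphere (0 : V) 1).eq_empty_or_nonempty with h | h
    · exact ⟨1, one_pos, fun x hx => by simp [h] at hx⟩
    · obtain ⟨x, hx, hxm⟩ := (isCompact_sphere (0 : V) 1).exists_isMinOn h hq.continuousOn
      exact ⟨q x, hpos x (by rintro rfl; simp at hx), fun y hy => hxm hy⟩
  refine Metric.isCompact_of_isClosed_isBounded (isClosed_le hq continuous_const)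
    (isBounded_iff_forall_norm_le.2 ⟨r / δ + 1, fun x hx => ?_⟩)
  have hx' : q x ≤ r := hx
  have hxq : δ * ‖x‖ ^ 2 ≤ q x := by
    rcases eq_or_ne x 0 with rfl | h0
    · have := hsmul 0 0
      simp_all
    · have hn : ‖x‖ ≠ 0 := norm_ne_zero_iff.2 h0
      have h1 := hmin (‖x‖⁻¹ • x) (by simp [norm_smul, hn])
      rw [hsmul] at h1
      calc δ * ‖x‖ ^ 2 ≤ ‖x‖⁻¹ ^ 2 * q x * ‖x‖ ^ 2 := by gcongr
        _ = q x := by field_simp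
  have h2 : ‖x‖ ^ 2 ≤ r / δ := by
    rw [le_div_iff₀ hδ]; linarith
  nlinarith [sq_nonneg (‖x‖ - 1)]

/-- In the chart at `m`, the differential at `m` is the Fréchet derivative. -/
theorem HasMFDerivAt.hasFDerivAt_comp_symm {F V : Type*} [NormedAddCommGroup F] [NormedSpace ℝ F]
    [NormedAddCommGroup V] [NormedSpace ℝ V]
    {M : Type*} [TopologicalSpace M] [ChartedSpace F M] {f : M → V} {m : M} {A : F →L[ℝ] V}
    (h : HasMFDerivAt 𝓘(ℝ, F) 𝓘(ℝ, V) f m A) :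
    HasFDerivAt (f ∘ (extChartAt 𝓘(ℝ, F) m).symm) A (extChartAt 𝓘(ℝ, F) m m) := by
  have h1 : HasFDerivWithinAt (f ∘ (extChartAt 𝓘(ℝ, F) m).symm) A (Set.range 𝓘(ℝ, F))
    (extChartAt 𝓘(ℝ, F) m m) := h.2
  rwa [modelWithCornersSelf_coe, Set.range_id, hasFDerivWithinAt_univ] at h1

/-- The differential of a function on a manifold without boundary vanishes at a local minimum. -/
theorem IsLocalMin.mfderiv_eq_zero {F : Type*} [NormedAddCommGroup F] [NormedSpace ℝ F]
    {M : Type*} [TopologicalSpace M] [ChartedSpace F M] {f : M → ℝ} {m : M} (h : IsLocalMin f m) :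
    mfderiv 𝓘(ℝ, F) 𝓘(ℝ, ℝ) f m = 0 := by
  by_cases hd : MDifferentiableAt 𝓘(ℝ, F) 𝓘(ℝ, ℝ) f m
  · have h1 : IsLocalMin (f ∘ (extChartAt 𝓘(ℝ, F) m).symm) (extChartAt 𝓘(ℝ, F) m m) := by
      have hs : (extChartAt 𝓘(ℝ, F) m).symm (extChartAt 𝓘(ℝ, F) m m) = m := extChartAt_to_inv m
      have hc : Filter.Tendsto (extChartAt 𝓘(ℝ, F) m).symm (𝓝 (extChartAt 𝓘(ℝ, F) m m)) (𝓝 m) := by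
        have := continuousAt_extChartAt_symm (I := 𝓘(ℝ, F)) m
        rw [ContinuousAt, hs] at this
        exact this
      filter_upwards [hc.eventually h] with x hx
      simpa [hs] using hx
    exact h1.hasFDerivAt_eq_zero hd.hasMFDerivAt.hasFDerivAt_comp_symm
  · exact mfderiv_zero_of_not_mdifferentiableAt hd

end Analysis

section CriticalPoints

variable {E : Type*} [NormedAddCommGroup E] [NormedSpace ℝ E] [FiniteDimensional ℝ E]
  {G : Type*} [TopologicalSpace G] [ChartedSpace E G] [Group G]
  {F : Type*} [NormedAddCommGroup F] [NormedSpace ℝ F]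
  {M : Type*} [TopologicalSpace M] [ChartedSpace F M]

namespace RealReductive

variable (R : RealReductive E G)

theorem apply_sharp_comm (α β : E →L[ℝ] ℝ) : α (R.sharp β) = β (R.sharp α) := by
  rw [← R.modelForm_sharp α, ← R.modelForm_sharp β, R.modelForm_modelTheta_right,
    R.modelForm_symm]

theorem apply_projK_sharp_comm (α β : E →L[ℝ] ℝ) :
    α (R.projK (R.sharp β)) = β (R.projK (R.sharp α)) := by
  rw [R.apply_eq_of_theta_eq α (R.modelTheta_projK _),
    R.apply_eq_of_theta_eq β (R.modelTheta_projK _), R.modelForm_symm]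

theorem normSq_eq_apply (α : E →L[ℝ] ℝ) :
    R.normSq (α : StrongDual ℝ (GroupLieAlgebra 𝓘(ℝ, E) G)) = α (R.sharp α) := by
  rw [normSq_eq, modelForm_sharp]

theorem normSqK_eq_apply (α : E →L[ℝ] ℝ) :
    R.normSqK ((α : StrongDual ℝ (GroupLieAlgebra 𝓘(ℝ, E) G)).comp R.𝔨.subtypeL) =
      α (R.projK (R.sharp α)) := by
  rw [normSqK_eq, R.apply_eq_of_theta_eq α (R.modelTheta_projK _)]

theorem isCompact_apply_sharp_le (r : ℝ) : IsCompact {α : E →L[ℝ] ℝ | α (R.sharp α) ≤ r} := by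
  refine isCompact_sublevel_of_posDef (by fun_prop) (fun c α => ?_) (fun α hα => ?_) r
  · simp only [map_smul, smul_apply, smul_eq_mul]
    ring
  · have h0 : R.sharp α ≠ 0 := by
      intro h
      refine hα ?_
      ext X
      rw [← R.modelForm_sharp, h]
      simp
    have := R.modelForm_theta_neg h0
    rw [← R.modelForm_sharp]
    linarith

theorem modelForm_modelBracket_rotate [LieGroup 𝓘(ℝ, E) ∞ G] [T2Space G] (X Y Z : E) :
    R.modelForm (modelBracket E G X Y) Z = R.modelForm (modelBracket E G Z X) Y := by
  have := FiniteDimensional.complete ℝ E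
  rw [R.modelForm_modelBracket, modelBracket_skew X Z, map_neg, neg_neg, R.modelForm_symm]

/-- `[k + p, k - p] = -2 [k, p]`. -/
theorem modelBracket_projK_projP [LieGroup 𝓘(ℝ, E) ∞ G] [T2Space G] {X : E}
    (h : modelBracket E G X (R.modelTheta X) = 0) :
    modelBracket E G (R.projK X) (R.projP X) = 0 := by
  have := FiniteDimensional.complete ℝ E
  rw [R.modelTheta_eq] at h
  nth_rewrite 1 [← R.projK_add_projP X] at h
  simp only [map_add, map_sub, add_apply, modelBracket_self] at h
  rw [modelBracket_skew (R.projP X)] at h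
  have h2 : (2 : ℝ) • modelBracket E G (R.projK X) (R.projP X) = 0 := by
    rw [two_smul, ← neg_eq_zero, ← h]
    abel
  simpa using h2

theorem isCompact_normSq_le {Φ : M → StrongDual ℝ (GroupLieAlgebra 𝓘(ℝ, E) G)}
    (hΦ : IsProperMap Φ) (r : ℝ) :
    IsCompact {m | R.normSq (Φ m) ≤ r} := by
  have h1 : {m | R.normSq (Φ m) ≤ r} = Φ ⁻¹' {α : E →L[ℝ] ℝ | α (R.sharp α) ≤ r} := by
    ext m
    exact iff_of_eq (congrArg (· ≤ r) (R.normSq_eq_apply (modelMoment Φ m)))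
  rw [h1]
  exact hΦ.isCompact_preimage (R.isCompact_apply_sharp_le r)

end RealReductive

variable [MulAction G M]
  {Ω : ∀ m : M, TangentSpace 𝓘(ℝ, F) m [⋀^Fin 2]→L[ℝ] ℝ}
  {Φ : M → StrongDual ℝ (GroupLieAlgebra 𝓘(ℝ, E) G)}

namespace IsHamiltonian

/-- The differential of a quadratic function of the moment map. -/
theorem hasMFDerivAt_quadratic (h : IsHamiltonian Ω Φ) {T : (E →L[ℝ] ℝ) →L[ℝ] E}
    (hT : ∀ α β : E →L[ℝ] ℝ, α (T β) = β (T α)) (m : M) :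
    HasMFDerivAt 𝓘(ℝ, F) 𝓘(ℝ, ℝ) (fun x => modelMoment Φ x (T (modelMoment Φ x))) m
      ((2 : ℝ) • (modelMomentDeriv F Φ m).flip (T (modelMoment Φ m))) := by
  have h1 : HasFDerivAt (fun α : E →L[ℝ] ℝ => α (T α))
      ((2 : ℝ) • ContinuousLinearMap.apply ℝ ℝ (T (modelMoment Φ m))) (modelMoment Φ m) := by
    refine ((hasFDerivAt_id _).clm_apply T.hasFDerivAt).congr_fderiv ?_
    ext β
    simp [hT _ β, two_mul]
  exact HasMFDerivAt.comp m h1.hasMFDerivAt (h.hasMFDerivAt_modelMoment m)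

theorem mfderiv_quadratic_eq_zero_iff (h : IsHamiltonian Ω Φ) {T : (E →L[ℝ] ℝ) →L[ℝ] E}
    (hT : ∀ α β : E →L[ℝ] ℝ, α (T β) = β (T α)) (m : M) :
    mfderiv 𝓘(ℝ, F) 𝓘(ℝ, ℝ) (fun x => modelMoment Φ x (T (modelMoment Φ x))) m = 0 ↔
      ∀ v : F, modelMomentDeriv F Φ m v (T (modelMoment Φ m)) = 0 := by
  rw [(h.hasMFDerivAt_quadratic hT m).mfderiv]
  have h2 : (2 : ℝ) • (modelMomentDeriv F Φ m).flip (T (modelMoment Φ m)) = 0 ↔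
      ∀ v : F, modelMomentDeriv F Φ m v (T (modelMoment Φ m)) = 0 := by
    rw [smul_eq_zero, or_iff_right two_ne_zero, ContinuousLinearMap.ext_iff]
    rfl
  exact h2

theorem mem_criticalSet_normSq_iff (h : IsHamiltonian Ω Φ) (R : RealReductive E G) (m : M) :
    m ∈ criticalSet F (fun m => R.normSq (Φ m)) ↔
      ∀ v : F, modelMomentDeriv F Φ m v (R.sharp (modelMoment Φ m)) = 0 := by
  have h1 : (fun m => R.normSq (Φ m)) = fun m => modelMoment Φ m (R.sharp (modelMoment Φ m)) :=
    funext fun m => R.normSq_eq_apply (modelMoment Φ m)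
  rw [h1]
  exact h.mfderiv_quadratic_eq_zero_iff R.apply_sharp_comm m

theorem mem_criticalSet_normSqK_iff (h : IsHamiltonian Ω Φ) (R : RealReductive E G) (m : M) :
    m ∈ criticalSet F (fun m => R.normSqK (R.momentK Φ m)) ↔
      ∀ v : F, modelMomentDeriv F Φ m v (R.projK (R.sharp (modelMoment Φ m))) = 0 := by
  have h1 : (fun m => R.normSqK (R.momentK Φ m)) =
      fun m => modelMoment Φ m ((R.projK.comp R.sharp) (modelMoment Φ m)) :=
    funext fun m => R.normSqK_eq_apply (modelMoment Φ m)
  rw [h1]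
  exact h.mfderiv_quadratic_eq_zero_iff R.apply_projK_sharp_comm m

theorem continuous_normSq (h : IsHamiltonian Ω Φ) (R : RealReductive E G) :
    Continuous fun m => R.normSq (Φ m) := by
  have h1 : (fun m => R.normSq (Φ m)) = fun m => modelMoment Φ m (R.sharp (modelMoment Φ m)) :=
    funext fun m => R.normSq_eq_apply (modelMoment Φ m)
  rw [h1]
  have := h.contMDiff_modelMoment.continuous
  fun_prop

theorem criticalSet_normSq_nonempty [Nonempty M] (h : IsHamiltonian Ω Φ) (R : RealReductive E G)
    (hΦ : IsProperMap Φ) : (criticalSet F (fun m => R.normSq (Φ m))).Nonempty := by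
  obtain ⟨m₁⟩ := ‹Nonempty M›
  obtain ⟨m, hm, hmin⟩ := (R.isCompact_normSq_le hΦ (R.normSq (Φ m₁))).exists_isMinOn
    ⟨m₁, le_refl (R.normSq (Φ m₁))⟩ (h.continuous_normSq R).continuousOn
  refine ⟨m, IsLocalMin.mfderiv_eq_zero (Filter.Eventually.of_forall fun x => ?_)⟩
  rcases le_total (R.normSq (Φ x)) (R.normSq (Φ m₁)) with hx | hx
  · exact hmin hx
  · exact le_trans hm hx

variable [LieGroup 𝓘(ℝ, E) ∞ G] [T2Space G]

theorem criticalSet_normSq_subset (h : IsHamiltonian Ω Φ) (R : RealReductive E G)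
    (hG : IsProperAction G M) (hΦ : IsProperMap Φ) :
    criticalSet F (fun m => R.normSq (Φ m)) ⊆ R.slice Φ := by
  intro m hm
  have h1 := h.modelBracket_eq_zero R ((h.mem_criticalSet_normSq_iff R m).1 hm)
  rw [R.sharpForm_apply, map_neg, neg_eq_zero] at h1
  exact h.mem_slice_of_modelBracket_eq_zero R hG hΦ (R.modelBracket_projK_projP h1)

theorem criticalSet_normSqK_subset (h : IsHamiltonian Ω Φ) (R : RealReductive E G)
    (hG : IsProperAction G M) (hΦ : IsProperMap Φ) :
    criticalSet F (fun m => R.normSqK (R.momentK Φ m)) ⊆ R.slice Φ := by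
  have := FiniteDimensional.complete ℝ E
  intro m hm
  have h1 := h.modelBracket_eq_zero R ((h.mem_criticalSet_normSqK_iff R m).1 hm)
  rw [R.sharpForm_apply, map_neg, neg_eq_zero, R.modelTheta_eq, map_sub, modelBracket_self,
    zero_sub, neg_eq_zero] at h1
  exact h.mem_slice_of_modelBracket_eq_zero R hG hΦ h1

theorem criticalSet_normSq_eq (h : IsHamiltonian Ω Φ) (R : RealReductive E G)
    (hG : IsProperAction G M) (hΦ : IsProperMap Φ) :
    criticalSet F (fun m => R.normSq (Φ m)) =
      criticalSet F (fun m => R.normSqK (R.momentK Φ m)) := by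
  have hY : ∀ m ∈ R.slice Φ, R.projK (R.sharp (modelMoment Φ m)) = R.sharp (modelMoment Φ m) := by
    intro m hm
    have h1 : R.projP (R.sharp (modelMoment Φ m)) = 0 := (R.mem_slice_iff Φ m).1 hm
    have h2 := R.projK_add_projP (R.sharp (modelMoment Φ m))
    rwa [h1, add_zero] at h2
  ext m
  constructor
  · intro hm
    rw [h.mem_criticalSet_normSqK_iff, hY m (h.criticalSet_normSq_subset R hG hΦ hm)]
    exact (h.mem_criticalSet_normSq_iff R m).1 hm
  · intro hm
    rw [h.mem_criticalSet_normSq_iff, ← hY m (h.criticalSet_normSqK_subset R hG hΦ hm)]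
    exact (h.mem_criticalSet_normSqK_iff R m).1 hm

/-- If `Φ` is proper, then every orbit meets the slice: a point of the orbit at which `‖Φ‖²` is
minimal lies in the slice. -/
theorem exists_smul_mem_slice (h : IsHamiltonian Ω Φ) (R : RealReductive E G)
    (hG : IsProperAction G M) (hΦ : IsProperMap Φ) (m : M) : ∃ g : G, g • m ∈ R.slice Φ := by
  have := FiniteDimensional.complete ℝ E
  have hcont : Continuous fun g : G => g • m :=
    (h.smooth_action.comp (contMDiff_id.prodMk contMDiff_const)).continuous
  -- outside the compact set of all `g` moving some point of the sublevel set of `m` into that set,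
  -- `‖Φ(g • m)‖²` exceeds its value at `g = 1`
  obtain ⟨g, hg, hmin⟩ := (hG _ (R.isCompact_normSq_le hΦ (R.normSq (Φ m)))).exists_isMinOn
    ⟨1, m, le_refl (R.normSq (Φ m)), by simp⟩ ((h.continuous_normSq R).comp hcont).continuousOn
  have hmin' : ∀ g' : G, R.normSq (Φ (g • m)) ≤ R.normSq (Φ (g' • m)) := by
    intro g'
    rcases le_total (R.normSq (Φ (g' • m))) (R.normSq (Φ m)) with hx | hx
    · exact hmin ⟨m, le_refl (R.normSq (Φ m)), hx⟩
    · refine le_trans ?_ hx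
      have := hmin (show (1 : G) ∈ _ from ⟨m, le_refl (R.normSq (Φ m)), by simp⟩)
      simpa using this
  refine ⟨g, h.mem_slice_of_modelBracket_eq_zero R hG hΦ (R.modelBracket_projK_projP ?_)⟩
  set n := g • m with hn
  have hT : HasMFDerivAt 𝓘(ℝ, F) 𝓘(ℝ, ℝ)
      (fun x => modelMoment Φ x (R.sharp (modelMoment Φ x))) ((1 : G) • n)
      ((2 : ℝ) • (modelMomentDeriv F Φ n).flip (R.sharp (modelMoment Φ n))) := by
    rw [one_smul]; exact h.hasMFDerivAt_quadratic R.apply_sharp_comm n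
  have ho : HasMFDerivAt 𝓘(ℝ, E) 𝓘(ℝ, F) (fun g : G => g • n) 1 (orbitDeriv E G F n) :=
    (h.mdifferentiable_smul n 1).hasMFDerivAt
  have hd := (HasMFDerivAt.comp (1 : G) hT ho).mfderiv
  have hloc : IsLocalMin ((fun x => modelMoment Φ x (R.sharp (modelMoment Φ x))) ∘
      fun g : G => g • n) 1 := by
    refine Filter.Eventually.of_forall fun g' => ?_
    have h1 := hmin' (g' * g)
    rw [mul_smul, ← hn] at h1
    have e : ∀ x, R.normSq (Φ x) = modelMoment Φ x (R.sharp (modelMoment Φ x)) :=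
      fun x => R.normSq_eq_apply (modelMoment Φ x)
    rw [e, e] at h1
    simpa using h1
  -- the derivative of `‖Φ‖²` in the direction `Z` of the orbit is `2 b([Z, η], ξ) = 2 b([η, ξ], Z)`
  have hz := hd.symm.trans hloc.mfderiv_eq_zero
  have hZ : ∀ Z : E, modelMomentDeriv F Φ n (orbitDeriv E G F n Z)
      (R.sharp (modelMoment Φ n)) = 0 := by
    intro Z
    have h1 : (2 : ℝ) * modelMomentDeriv F Φ n (orbitDeriv E G F n Z)
      (R.sharp (modelMoment Φ n)) = 0 := congrArg (fun A : E →L[ℝ] ℝ => A Z) hz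
    linarith
  refine R.eq_zero_of_modelForm_eq_zero fun Z => ?_
  have h2 := hZ Z
  rw [h.modelMomentDeriv_orbitDeriv R, R.sharpForm_apply, map_neg, map_neg, neg_apply,
    R.modelForm_symm] at h2
  rw [R.modelForm_modelBracket_rotate, R.modelForm_modelBracket, h2]

/-- If `Φ` is proper, the `𝔭`-component of `Φ` is dominated by its `𝔨`-component: the difference
of the squared norms is invariant under `G` and nonnegative on the slice. -/
theorem normSq_le_two_mul (h : IsHamiltonian Ω Φ) (R : RealReductive E G)
    (hG : IsProperAction G M) (hΦ : IsProperMap Φ) (m : M) :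
    R.normSq (Φ m) ≤ 2 * R.normSqK (R.momentK Φ m) := by
  obtain ⟨g, hg⟩ := h.exists_smul_mem_slice R hG hΦ m
  have key : ∀ α : E →L[ℝ] ℝ, 0 ≤ -R.modelForm (R.sharpForm α) (R.sharpForm α) →
      R.normSq (α : StrongDual ℝ (GroupLieAlgebra 𝓘(ℝ, E) G)) ≤
        2 * R.normSqK ((α : StrongDual ℝ (GroupLieAlgebra 𝓘(ℝ, E) G)).comp R.𝔨.subtypeL) := by
    intro α hα
    rw [R.neg_modelForm_sharpForm] at hα
    linarith [R.normSq_eq_add α]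
  refine key (modelMoment Φ m) ?_
  have h2 := R.neg_modelForm_sharpForm (modelMoment Φ (g • m))
  have h3 : R.projP (R.sharp (modelMoment Φ (g • m))) = 0 := (R.mem_slice_iff Φ _).1 hg
  rw [h.sharpForm_smul R, R.modelForm_modelAd, h3, map_zero, sub_zero] at h2
  rw [h2]
  exact R.normSqK_nonneg _

end IsHamiltonian

end CriticalPoints

/-! ### Smooth curves in the slice -/

section Curves

/-- A tangent vector to a fibre of a submersion is the velocity of a smooth curve in that fibre. -/
theorem exists_contDiffOn_curve_in_fibre {F W : Type*} [NormedAddCommGroup F] [NormedSpace ℝ F]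
    [NormedAddCommGroup W] [NormedSpace ℝ W] [FiniteDimensional ℝ W] {h : F → W} {U : Set F}
    (hU : IsOpen U) (hh : ContDiffOn ℝ ∞ h U) {x₀ : F} (hx₀ : x₀ ∈ U) (h0 : h x₀ = 0)
    {h' : F →L[ℝ] W} (hd : HasFDerivAt h h' x₀) (hsurj : Function.Surjective h') {w : F}
    (hw : h' w = 0) :
    ∃ (ε : ℝ) (c : ℝ → F), 0 < ε ∧ ContDiffOn ℝ ∞ c (Set.Ioo (-ε) ε) ∧ c 0 = x₀ ∧
      HasDerivAt c w 0 ∧ ∀ t ∈ Set.Ioo (-ε) ε, c t ∈ U ∧ h (c t) = 0 := by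
  have := FiniteDimensional.complete ℝ W
  obtain ⟨A₀, hA₀⟩ := LinearMap.exists_rightInverse_of_surjective h'.toLinearMap
    (LinearMap.range_eq_top.2 hsurj)
  let A : W →L[ℝ] F := LinearMap.toContinuousLinearMap A₀
  have hA : ∀ ζ, h' (A ζ) = ζ := fun ζ => LinearMap.congr_fun hA₀ ζ
  -- `g (t, ζ) = x₀ + t w + A ζ`, with `A` a right inverse of `h'`; the curve is `t ↦ g (t, ζ(t))`,
  -- where `ζ(t)` solves `h (g (t, ζ)) = 0`
  let L : ℝ × W →L[ℝ] F :=
    (ContinuousLinearMap.fst ℝ ℝ W).smulRight w + A.comp (ContinuousLinearMap.snd ℝ ℝ W)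
  let g : ℝ × W → F := fun p => x₀ + L p
  have hg : ContDiff ℝ ∞ g := contDiff_const.add L.contDiff
  have hg0 : g 0 = x₀ := by simp [g]
  let H : ℝ × W → ℝ × W := fun p => (p.1, h (g p))
  have hV : IsOpen (g ⁻¹' U) := hU.preimage hg.continuous
  have hV0 : (0 : ℝ × W) ∈ g ⁻¹' U := by simpa [hg0] using hx₀
  have hH : ContDiffOn ℝ ∞ H (g ⁻¹' U) :=
    contDiffOn_fst.prodMk (hh.comp hg.contDiffOn (Set.mapsTo_preimage g U))
  have hHat : ∀ p ∈ g ⁻¹' U, ContDiffAt ℝ ∞ H p := fun p hp => hH.contDiffAt (hV.mem_nhds hp)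
  have hHd : HasFDerivAt H ((ContinuousLinearEquiv.refl ℝ (ℝ × W) : (ℝ × W) ≃L[ℝ] ℝ × W) :
      ℝ × W →L[ℝ] ℝ × W) 0 := by
    have h1 : HasFDerivAt h h' (g 0) := by rw [hg0]; exact hd
    refine ((hasFDerivAt_fst (p := (0 : ℝ × W))).prodMk
      (h1.comp 0 (L.hasFDerivAt.const_add x₀))).congr_fderiv ?_
    refine ContinuousLinearMap.ext fun p => Prod.ext rfl ?_
    simp [L, hw, hA]
  have h1 : (∞ : WithTop ℕ∞) ≠ 0 := by simp
  let e := (hHat 0 hV0).toOpenPartialHomeomorph H hHd h1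
  have heH : ∀ p, e p = H p := fun p => rfl
  have he0 : (0 : ℝ × W) ∈ e.source := (hHat 0 hV0).mem_toOpenPartialHomeomorph_source hHd h1
  have hH0 : H 0 = 0 := by simp [H, hg0, h0]
  have hs0 : e.symm 0 = 0 := by
    have := e.left_inv he0
    rwa [heH, hH0] at this
  have ht0 : (0 : ℝ × W) ∈ e.target := by
    have := e.map_source he0
    rwa [heH, hH0] at this
  -- near `0` the differential of `H` is invertible, so that the local inverse is smooth
  have hN : ∀ᶠ p in 𝓝 (0 : ℝ × W), p ∈ g ⁻¹' U ∧
      ∃ B : (ℝ × W) ≃L[ℝ] ℝ × W, HasFDerivAt H (B : ℝ × W →L[ℝ] ℝ × W) p := by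
    have hc : ContinuousAt (fderiv ℝ H) 0 := ((hHat 0 hV0).fderiv_right (m := 0)
      (by simp)).continuousAt
    have hr : Set.range ((↑) : ((ℝ × W) ≃L[ℝ] ℝ × W) → (ℝ × W →L[ℝ] ℝ × W)) ∈
        𝓝 (fderiv ℝ H 0) := by
      rw [hHd.fderiv]
      exact ContinuousLinearEquiv.nhds _
    filter_upwards [hV.mem_nhds hV0, hc.eventually hr] with p hp hB
    obtain ⟨B, hB⟩ := hB
    refine ⟨hp, B, ?_⟩
    rw [hB]
    exact ((hHat p hp).differentiableAt h1).hasFDerivAt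
  let s : ℝ → ℝ × W := fun t => e.symm (t, 0)
  have hcs : ContinuousAt (fun t : ℝ => ((t, 0) : ℝ × W)) 0 := by fun_prop
  have hev : ∀ᶠ t in 𝓝 (0 : ℝ), ((t, 0) : ℝ × W) ∈ e.target ∧ s t ∈ g ⁻¹' U ∧
      ∃ B : (ℝ × W) ≃L[ℝ] ℝ × W, HasFDerivAt H (B : ℝ × W →L[ℝ] ℝ × W) (s t) := by
    have hsc : Filter.Tendsto s (𝓝 0) (𝓝 0) := by
      have h2 : ContinuousAt e.symm ((0, 0) : ℝ × W) := e.continuousAt_symm ht0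
      have h3 : ContinuousAt s 0 := ContinuousAt.comp (f := fun t : ℝ => ((t, 0) : ℝ × W)) h2 hcs
      have h4 : s 0 = 0 := hs0
      rwa [ContinuousAt, h4] at h3
    exact (hcs.eventually (e.open_target.mem_nhds ht0)).and (hsc.eventually hN)
  obtain ⟨ε, hε, hI⟩ := Metric.eventually_nhds_iff_ball.1 hev
  rw [Real.ball_eq_Ioo, zero_sub, zero_add] at hI
  have hsol : ∀ t ∈ Set.Ioo (-ε) ε, (s t).1 = t ∧ h (g (s t)) = 0 := by
    intro t ht
    have h2 := e.right_inv (hI t ht).1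
    rw [heH] at h2
    exact ⟨congrArg Prod.fst h2, congrArg Prod.snd h2⟩
  refine ⟨ε, fun t => g (s t), hε, fun t ht => ?_, ?_, ?_,
    fun t ht => ⟨(hI t ht).2.1, (hsol t ht).2⟩⟩
  · obtain ⟨hT, hVt, B, hB⟩ := hI t ht
    have h2 : ContDiffAt ℝ ∞ e.symm (t, 0) := e.contDiffAt_symm hT hB (hHat _ hVt)
    have h3 : ContDiffAt ℝ ∞ s t :=
      ContDiffAt.comp t h2 (contDiffAt_id.prodMk contDiffAt_const)
    exact (hg.contDiffAt.comp t h3).contDiffWithinAt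
  · change g (e.symm 0) = x₀
    rw [hs0, hg0]
  · have h2 : HasFDerivAt e.symm ((ContinuousLinearEquiv.refl ℝ (ℝ × W)).symm :
        ℝ × W →L[ℝ] ℝ × W) ((0, 0) : ℝ × W) := by
      refine e.hasFDerivAt_symm ht0 ?_
      change HasFDerivAt H _ (e.symm 0)
      rw [hs0]
      exact hHd
    have h3 : HasDerivAt (fun t : ℝ => ((t, 0) : ℝ × W)) (1, 0) 0 :=
      (hasDerivAt_id 0).prodMk (hasDerivAt_const 0 0)
    have h4 : HasDerivAt s (1, 0) 0 := 
      HasFDerivAt.comp_hasDerivAt (f := fun t : ℝ => ((t, 0) : ℝ × W)) (0 : ℝ) h2 h3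
    have h5 := (L.hasFDerivAt.comp_hasDerivAt (0 : ℝ) h4).const_add x₀
    have h6 : L (1, 0) = w := by simp [L]
    rw [h6] at h5
    exact h5

end Curves

section Slice

variable {E : Type*} [NormedAddCommGroup E] [NormedSpace ℝ E] [FiniteDimensional ℝ E]
  {G : Type*} [TopologicalSpace G] [ChartedSpace E G] [Group G]
  {F : Type*} [NormedAddCommGroup F] [NormedSpace ℝ F]
  {M : Type*} [TopologicalSpace M] [ChartedSpace F M] [MulAction G M]
  {Ω : ∀ m : M, TangentSpace 𝓘(ℝ, F) m [⋀^Fin 2]→L[ℝ] ℝ}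
  {Φ : M → StrongDual ℝ (GroupLieAlgebra 𝓘(ℝ, E) G)}

namespace RealReductive

/-- The component in `𝔭` of the dual vector of a linear form. -/
def sharpP (R : RealReductive E G) : (E →L[ℝ] ℝ) →L[ℝ] R.projP.range :=
  (R.projP.comp R.sharp).codRestrict R.projP.range fun α => ⟨R.sharp α, rfl⟩

theorem sharpP_eq_zero_iff (R : RealReductive E G) (α : E →L[ℝ] ℝ) :
    R.sharpP α = 0 ↔ R.projP (R.sharp α) = 0 := Subtype.ext_iff

end RealReductive

namespace IsHamiltonian

theorem criticalSet_inter_slice_subset (h : IsHamiltonian Ω Φ)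
    (R : RealReductive E G) :
    criticalSet F (fun m => R.normSqK (R.momentK Φ m)) ∩ R.slice Φ ⊆
      criticalSetOn F (fun m => R.normSqK (R.momentK Φ m)) (R.slice Φ) := by
  rintro y ⟨hy, hyS⟩
  refine ⟨hyS, fun ε γ hε hγ _ h0 => ?_⟩
  have h2 : (fun m => R.normSqK (R.momentK Φ m)) =
      fun m => modelMoment Φ m ((R.projK.comp R.sharp) (modelMoment Φ m)) :=
    funext fun m => R.normSqK_eq_apply (modelMoment Φ m)
  have hd : MDifferentiableAt 𝓘(ℝ, ℝ) 𝓘(ℝ, F) γ 0 :=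
    (hγ.contMDiffAt (Ioo_mem_nhds (by linarith) hε)).mdifferentiableAt (by simp)
  have hq : HasMFDerivAt 𝓘(ℝ, F) 𝓘(ℝ, ℝ) (fun m => R.normSqK (R.momentK Φ m)) (γ 0)
      (0 : F →L[ℝ] ℝ) := by
    rw [h0]
    have h3 := (h.hasMFDerivAt_quadratic (T := R.projK.comp R.sharp)
      R.apply_projK_sharp_comm y).mdifferentiableAt
    rw [← h2] at h3
    exact h3.hasMFDerivAt.congr_mfderiv hy
  have h4 : HasFDerivAt ((fun m => R.normSqK (R.momentK Φ m)) ∘ γ)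
      ((0 : F →L[ℝ] ℝ).comp (mfderiv 𝓘(ℝ, ℝ) 𝓘(ℝ, F) γ 0 : ℝ →L[ℝ] F)) 0 :=
    (HasMFDerivAt.comp (0 : ℝ) hq hd.hasMFDerivAt).hasFDerivAt
  exact h4.hasDerivAt.deriv

variable [LieGroup 𝓘(ℝ, E) ∞ G] [T2Space G]

/-- At a point of the slice, `Φ^𝔭` restricted to the directions of `𝔭` is a submersion: the kernel
of `X ↦ dΦ^𝔭(X_M)` consists of the elements of `𝔭` that centralize `Φ(m)`. -/
theorem exists_sharpP_orbitDeriv_eq (h : IsHamiltonian Ω Φ) (R : RealReductive E G)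
    (hG : IsProperAction G M) (hΦ : IsProperMap Φ) {m : M} (hm : m ∈ R.slice Φ)
    (ζ : R.projP.range) :
    ∃ X : E, R.sharpP (modelMomentDeriv F Φ m (orbitDeriv E G F m X)) = ζ := by
  let S : R.projP.range →ₗ[ℝ] R.projP.range :=
    (R.sharpP.comp ((modelMomentDeriv F Φ m).comp (orbitDeriv E G F m))).toLinearMap ∘ₗ
      R.projP.range.subtype
  have hS : Function.Injective S := by
    rw [← LinearMap.ker_eq_bot, LinearMap.ker_eq_bot']
    rintro ⟨X, Z, rfl⟩ hX
    have hθX : R.modelTheta (R.projP Z) = -R.projP Z := R.modelTheta_projP Z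
    have hX0 : R.projP (R.sharp (modelMomentDeriv F Φ m (orbitDeriv E G F m (R.projP Z)))) = 0 :=
      (R.sharpP_eq_zero_iff _).1 hX
    have hξ : R.projP (R.sharp (modelMoment Φ m)) = 0 := (R.mem_slice_iff Φ m).1 hm
    have hη : R.modelTheta (R.sharpForm (modelMoment Φ m)) = R.sharpForm (modelMoment Φ m) := by
      rw [R.sharpForm_apply, R.modelTheta_eq (R.sharp _), hξ, sub_zero, map_neg,
        R.modelTheta_projK]
    have hB : R.modelTheta (modelBracket E G (R.projP Z) (R.sharpForm (modelMoment Φ m))) =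
        -modelBracket E G (R.projP Z) (R.sharpForm (modelMoment Φ m)) := by
      rw [R.modelTheta_modelBracket, hθX, hη, map_neg]
      rfl
    have h1 := R.apply_eq_of_theta_eq_neg
      (modelMomentDeriv F Φ m (orbitDeriv E G F m (R.projP Z))) hB
    rw [hX0, map_zero, h.modelMomentDeriv_orbitDeriv R] at h1
    have h2 : modelBracket E G (R.projP Z) (R.sharpForm (modelMoment Φ m)) = 0 :=
      R.eq_zero_of_modelForm_theta_nonneg (by rw [hB, map_neg, h1]; simp)
    exact Subtype.ext (h.eq_zero_of_modelBracket_eq_zero R hG hΦ hθX h2)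
  obtain ⟨X, hX⟩ := (LinearMap.injective_iff_surjective.1 hS) ζ
  exact ⟨X, hX⟩

/-- At a point `y` of the slice, `T_y M` is spanned by the directions of `𝔭`, along which `‖Φ^K‖²`
is stationary, and by the kernel of `dΦ^𝔭`, whose elements are velocities of curves in the slice. -/
theorem criticalSetOn_subset [IsManifold 𝓘(ℝ, F) ∞ M] (h : IsHamiltonian Ω Φ)
    (R : RealReductive E G) (hG : IsProperAction G M) (hΦ : IsProperMap Φ) :
    criticalSetOn F (fun m => R.normSqK (R.momentK Φ m)) (R.slice Φ) ⊆
      criticalSet F (fun m => R.normSqK (R.momentK Φ m)) := by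
  rintro y ⟨hy, hcr⟩
  rw [h.mem_criticalSet_normSqK_iff R]
  intro v
  obtain ⟨X, hX⟩ := h.exists_sharpP_orbitDeriv_eq R hG hΦ hy (R.sharpP (modelMomentDeriv F Φ y v))
  set ξ := R.sharp (modelMoment Φ y) with hξdef
  have hξ : R.projP ξ = 0 := (R.mem_slice_iff Φ y).1 hy
  -- the directions of `𝔭` do not contribute, by invariance of `b`
  have hXξ : modelMomentDeriv F Φ y (orbitDeriv E G F y X) (R.projK ξ) = 0 := by
    have h1 := R.modelForm_modelBracket X (R.projK ξ) (R.projK ξ)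
    rw [h.modelMomentDeriv_orbitDeriv R, R.sharpForm_apply, ← hξdef, R.modelTheta_eq, hξ, sub_zero,
      map_neg, map_neg, neg_apply, neg_eq_zero]
    rw [R.modelForm_symm (R.projK ξ)] at h1
    linarith
  set w := v - orbitDeriv E G F y X with hwdef
  have hw : R.sharpP (modelMomentDeriv F Φ y w) = 0 := by
    rw [hwdef, map_sub, map_sub, hX, sub_self]
  have hsub : modelMomentDeriv F Φ y v (R.projK ξ) = modelMomentDeriv F Φ y w (R.projK ξ) := by
    rw [hwdef, map_sub, sub_apply, hXξ, sub_zero]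
  rw [hsub]
  let e := extChartAt 𝓘(ℝ, F) y
  have hUo : IsOpen e.target := isOpen_extChartAt_target y
  have hes : ContMDiffOn 𝓘(ℝ, F) 𝓘(ℝ, F) ∞ e.symm e.target := contMDiffOn_extChartAt_symm y
  have hsm : ContDiffOn ℝ ∞ ((fun m => R.sharpP (modelMoment Φ m)) ∘ e.symm) e.target :=
    contMDiffOn_iff_contDiffOn.1
      ((R.sharpP.contDiff.contMDiff.comp h.contMDiff_modelMoment).comp_contMDiffOn hes)
  have hP : HasFDerivAt ((fun m => R.sharpP (modelMoment Φ m)) ∘ e.symm)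
      (R.sharpP.comp (modelMomentDeriv F Φ y)) (e y) := by
    refine HasMFDerivAt.hasFDerivAt_comp_symm ?_
    exact HasMFDerivAt.comp y R.sharpP.hasFDerivAt.hasMFDerivAt (h.hasMFDerivAt_modelMoment y)
  have hey : e.symm (e y) = y := extChartAt_to_inv y
  obtain ⟨ε, c, hε, hc, hc0, hcd, hcU⟩ := exists_contDiffOn_curve_in_fibre hUo hsm
    (mem_extChartAt_target y) (by
      change R.sharpP (modelMoment Φ (e.symm (e y))) = 0
      rw [hey, R.sharpP_eq_zero_iff]
      exact hξ) hP
    (fun ζ => (h.exists_sharpP_orbitDeriv_eq R hG hΦ hy ζ).imp' _ fun _ hX => hX) hw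
  have h0 := hcr ε (e.symm ∘ c) hε
    (hes.comp hc.contMDiffOn fun t ht => (hcU t ht).1)
    (fun t ht => (R.mem_slice_iff Φ _).2 ((R.sharpP_eq_zero_iff _).1 (hcU t ht).2))
    (by change e.symm (c 0) = y; rw [hc0]; exact hey)
  have hq := (h.hasMFDerivAt_quadratic (T := R.projK.comp R.sharp)
    R.apply_projK_sharp_comm y).hasFDerivAt_comp_symm
  have hq' : HasFDerivAt ((fun m => modelMoment Φ m ((R.projK.comp R.sharp) (modelMoment Φ m))) ∘
      e.symm) ((2 : ℝ) • (modelMomentDeriv F Φ y).flip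
        ((R.projK.comp R.sharp) (modelMoment Φ y))) (c 0) := by
    rw [hc0]; exact hq
  have h1 := (hq'.comp_hasDerivAt (0 : ℝ) hcd).deriv
  have h2 : (fun m => R.normSqK (R.momentK Φ m)) =
      fun m => modelMoment Φ m ((R.projK.comp R.sharp) (modelMoment Φ m)) :=
    funext fun m => R.normSqK_eq_apply (modelMoment Φ m)
  rw [h2, ← Function.comp_assoc, h1] at h0
  have h3 : (2 : ℝ) * modelMomentDeriv F Φ y w (R.projK ξ) = 0 := h0
  linarith

end IsHamiltonian

end Slice

/-! ### Properness of the moment maps -/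

section Properness

variable {E : Type*} [NormedAddCommGroup E] [NormedSpace ℝ E]
  {G : Type*} [TopologicalSpace G] [ChartedSpace E G] [Group G]
  {F : Type*} [NormedAddCommGroup F] [NormedSpace ℝ F]
  {M : Type*} [TopologicalSpace M] [ChartedSpace F M] [MulAction G M]
  {Ω : ∀ m : M, TangentSpace 𝓘(ℝ, F) m [⋀^Fin 2]→L[ℝ] ℝ}
  {Φ : M → StrongDual ℝ (GroupLieAlgebra 𝓘(ℝ, E) G)}

/-- The Lie algebra `𝔨`, as a subspace of the model space. -/
def RealReductive.modelK (R : RealReductive E G) : Submodule ℝ E := R.𝔨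

/-- The restriction of linear forms to `𝔨`. -/
def RealReductive.restrictK (R : RealReductive E G) :
    (E →L[ℝ] ℝ) →L[ℝ] (R.modelK →L[ℝ] ℝ) :=
  (ContinuousLinearMap.compL ℝ R.modelK E ℝ).flip R.modelK.subtypeL

/-- The extension by zero on `𝔭` of linear forms on `𝔨`. -/
def RealReductive.extendK (R : RealReductive E G) :
    (R.modelK →L[ℝ] ℝ) →L[ℝ] (E →L[ℝ] ℝ) :=
  (ContinuousLinearMap.compL ℝ E R.modelK ℝ).flip
    (R.projK.codRestrict R.modelK fun X => (R.mem_𝔨_iff _).2 (R.modelTheta_projK X))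

theorem RealReductive.restrictK_extendK (R : RealReductive E G) (β : R.modelK →L[ℝ] ℝ) :
    R.restrictK (R.extendK β) = β := by
  ext X
  have hX : R.modelTheta X.1 = X.1 := (R.mem_𝔨_iff _).1 X.2
  have h1 : R.projK X.1 = X.1 := by
    rw [R.projK_apply, hX, ← two_smul ℝ X.1, smul_smul]
    norm_num
  exact congrArg β (Subtype.ext h1)

variable [FiniteDimensional ℝ E] [LieGroup 𝓘(ℝ, E) ∞ G] [T2Space G]

/-- If `Φ` is proper then so is `‖Φ^K‖²`, which dominates `‖Φ‖² / 2`. -/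
theorem IsHamiltonian.isProperMap_iff (h : IsHamiltonian Ω Φ) (R : RealReductive E G)
    (hG : IsProperAction G M) : IsProperMap Φ ↔ IsProperMap (R.momentK Φ) := by
  have hcont : Continuous (modelMoment Φ) := h.contMDiff_modelMoment.continuous
  have hcontK : Continuous (R.restrictK ∘ modelMoment Φ) := R.restrictK.continuous.comp hcont
  constructor
  · intro hΦ
    change IsProperMap (R.restrictK ∘ modelMoment Φ)
    have hnorm : ∀ β : R.modelK →L[ℝ] ℝ, R.normSqK β =
        R.extendK β (R.projK (R.sharp (R.extendK β))) := by
      intro β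
      have h1 := R.normSqK_eq_apply (R.extendK β)
      rw [← h1]
      exact congrArg R.normSqK (R.restrictK_extendK β).symm
    have hcn : Continuous fun β : R.modelK →L[ℝ] ℝ => R.normSqK β := by
      simp_rw [hnorm]
      fun_prop
    refine isProperMap_of_comp_of_t2 hcontK hcn (isProperMap_iff_isCompact_preimage.2
      ⟨hcn.comp hcontK, fun C hC => ?_⟩)
    obtain ⟨r, hr⟩ := hC.bddAbove
    refine (R.isCompact_normSq_le hΦ (2 * r)).of_isClosed_subset
      (hC.isClosed.preimage (hcn.comp hcontK)) fun m hm => ?_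
    have h1 : R.normSqK (R.momentK Φ m) ≤ r := hr hm
    have h2 := h.normSq_le_two_mul R hG hΦ m
    change R.normSq (Φ m) ≤ 2 * r
    linarith
  · intro hK
    exact isProperMap_of_comp_of_t2 hcont R.restrictK.continuous hK

end Properness

theorem mainTheorem8
    {E : Type*} [NormedAddCommGroup E] [NormedSpace ℝ E] [FiniteDimensional ℝ E]
    {G : Type*} [TopologicalSpace G] [T2Space G] [ConnectedSpace G] [ChartedSpace E G]
    [Group G] [LieGroup 𝓘(ℝ, E) ∞ G]
    {F : Type*} [NormedAddCommGroup F] [NormedSpace ℝ F] [FiniteDimensional ℝ F]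
    {M : Type*} [TopologicalSpace M] [T2Space M] [SecondCountableTopology M] [ConnectedSpace M]
    [ChartedSpace F M] [IsManifold 𝓘(ℝ, F) ∞ M] [MulAction G M]
    (R : RealReductive E G)
    (Ω : ∀ m : M, TangentSpace 𝓘(ℝ, F) m [⋀^Fin 2]→L[ℝ] ℝ)
    (Φ : M → StrongDual ℝ (GroupLieAlgebra 𝓘(ℝ, E) G))
    (hΦ : IsHamiltonian Ω Φ)
    (hC1 : IsProperAction G M) :
    (IsProperMap Φ ↔ IsProperMap (R.momentK Φ)) ∧
    (IsProperMap Φ →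
      (criticalSet F (fun m => R.normSq (Φ m))).Nonempty ∧
      criticalSet F (fun m => R.normSq (Φ m)) =
        criticalSet F (fun m => R.normSqK (R.momentK Φ m)) ∧
      criticalSet F (fun m => R.normSqK (R.momentK Φ m)) =
        criticalSetOn F (fun m => R.normSqK (R.momentK Φ m)) (R.slice Φ) ∧
      criticalSet F (fun m => R.normSq (Φ m)) ⊆ R.slice Φ) := by
  refine ⟨hΦ.isProperMap_iff R hC1, fun hprop => ⟨hΦ.criticalSet_normSq_nonempty R hprop,
    hΦ.criticalSet_normSq_eq R hC1 hprop, ?_, hΦ.criticalSet_normSq_subset R hC1 hprop⟩⟩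
  refine Set.Subset.antisymm (fun m hm => ?_) (hΦ.criticalSetOn_subset R hC1 hprop)
  exact hΦ.criticalSet_inter_slice_subset R ⟨hm, hΦ.criticalSet_normSqK_subset R hC1 hprop hm⟩
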